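/- Let $R$ be a commutative ring containing $\mathbb Q$, let $n\ge 1$, and let $F=(F_i)_{1\le i\le n}$ be formal power series in $R[[X_1,\dots,X_n]]$ without constant term, written $F_i(X)=\sum_{d\ge1}\frac1{d!}\sum_{j_1,\dots,j_d}F^{[d]}_{i,j_1\dots j_d}X_{j_1}\cdots X_{j_d}$ with coefficients symmetric in $j_1,\dots,j_d$. Put $A=(F^{[1]}_{i,j})_{i,j}$, assume $A\in GL_n(R)$, and let $H_i$ be minus the sum of the terms of degree $\ge2$ of $F_i$, so that $F_i(X)=\sum_jA_{ij}X_j-H_i(X)$ and $H^{[p]}=-F^{[p]}$ for $p\ge 2$. *Formal Gaussian integral.* Let $\bar u,u,Y$ be vectors of $n$ indeterminates. For $U=\sum c_{\alpha_1,\alpha_2,\alpha_3}\bar u^{\alpha_1}u^{\alpha_2}Y^{\alpha_3}\in R[[\bar u,u,Y]]$ set $$\int d\bar u\,du\,e^{-\bar uAu}\,U=\sum_{\alpha_1,\alpha_2,\alpha_3}c_{\alpha_1,\alpha_2,\alpha_3}Y^{\alpha_3}(\det A)^{-1}\sum_{\sigma}\prod_{k}(A^{-1})_{\tau_2(\sigma(k))\,\tau_1(k)}\in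 R[[Y]],$$ where $\tau_r:[|\alpha_r|]\to[n]$ is any map taking each value $j$ exactly $(\alpha_r)_j$ times and $\sigma$ runs over the bijections $[|\alpha_1|]\to[|\alpha_2|]$; the integral is defined if for every $\alpha_3$ only finitely many $(\alpha_1,\alpha_2)$ contribute a nonzero term. Write $\bar uH(u)=\sum_i\bar u_iH_i(u)$ and $\bar uY=\sum_i\bar u_iY_i$. *Diagrams.* Let $I,J$ be finite sets. A Feynman diagram structure $\mathcal F$ of type $(I,J)$ on a finite set $E$ consists of decompositions $E=E_u\sqcup E_{\bar u}=E_{int}\sqcup E_{ext}$, bijections $\rho_u:I\to E_{ext}\cap E_u$ and $\rho_{\bar u}:J\to E_{ext}\cap E_{\bar u}$, disjoint sets $\pi_H,\pi_Y$ of subsets of $E$ whose union is a partition of $E_{int}$, such that each $B\in\pi_H$ ($H$-vertex) has exactly one element in $E_{\bar u}$ and at least two in $E_u$ and each $B\in\pi_Y$ ($Y$-vertex) is a single element of $E_{\bar u}$, and a bijection $\mathcal C:E_{\bar u}\to E_u$. Its digraph has as vertices the $H$-vertices, the $Y$-vertices and the singletons of $E_{ext}\cap E_u$ ($u$-sources)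 and of $E_{ext}\cap E_{\bar u}$ ($\bar u$-sources), with a link from $a$ to $b$ when $\mathcal C(x)\in b$ for some $x\in a\cap E_{\bar u}$. The diagram is connected if this digraph has a vertex and its underlying undirected graph is connected. It is tree-like if the digraph is a tree with all links oriented towards a root which is the unique $u$-source, whose leaves (vertices at which no link ends) are $Y$-vertices or $\bar u$-sources, and whose other non-root vertices are $H$-vertices at each of which at least two links end. Given $\tau_u:I\to[n]$ and $\tau_{\bar u}:J\to[n]$, the amplitude is $$\mathcal A(E,\mathcal F)=\sum_{\alpha}\prod_{x\in E_{\bar u}}(A^{-1})_{\alpha(\mathcal C(x))\,\alpha(x)}\prod_{B\in\pi_H}H^{[p]}_{\alpha(\bar x),\alpha(y_1)\dots\alpha(y_p)}\prod_{\{\bar x\}\in\pi_Y}Y_{\alpha(\bar x)}\in R[[Y]],$$ over all $\alpha:E\to[n]$ with $\alpha\circ\rho_u=\tau_u$ and $\alpha\circ\rho_{\bar u}=\tau_{\bar u}$, where $B\cap E_{\bar u}=\{\bar x\}$ and $B\cap E_u=\{y_1,\dots,y_p\}$ for $B\in\pi_H$. Isomorphisms are bijections $E\to E'$ transporting one structure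 to the other, and $\mathrm{Aut}(E,\mathcal F)$ is the resulting automorphism group. For $i\in[n]$ put $$\langle u_i\rangle_C=\sum_{[E,\mathcal F]}\frac{\mathcal A(E,\mathcal F)}{\#\mathrm{Aut}(E,\mathcal F)},$$ the sum over isomorphism classes of connected Feynman diagrams of type $([1],\emptyset)$, with $\tau_u(1)=i$. **Corollary 1.** For every $i\in[n]$ the two formal Gaussian integrals below are defined, the denominator is invertible in $R[[Y]]$, the sum defining $\langle u_i\rangle_C$ is summable in $R[[Y]]$ (each coefficient receives finitely many nonzero contributions), and $$\frac{\int d\bar u\,du\;e^{-\bar uAu}\,u_i\,e^{\bar uH(u)+\bar uY}}{\int d\bar u\,du\;e^{-\bar uAu}\,e^{\bar uH(u)+\bar uY}}=\langle u_i\rangle_C .$$ Moreover every connected Feynman diagram of type $([1],\emptyset)$ is tree-like, and all its leaves are $Y$-vertices. -/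

import Mathlib

open Finset

noncomputable section

namespace FeynRev

/-! ### Power series: tensor coefficients, linear and nonlinear parts, summable families -/

/-- The multiplicity multiindex `μ(τ)` of a finite family of indices `τ : K → [n]`. -/
def mult {n : ℕ} {K : Type*} [Fintype K] (τ : K → Fin n) : Fin n →₀ ℕ :=
  ∑ k, Finsupp.single (τ k) 1

/-- The tensor element `f^{[d]}_{j₁…j_d} = ∂^d f / ∂X_{j₁}…∂X_{j_d} (0)`, which depends only on the
multiplicity multiindex `m = μ(j₁,…,j_d)`: it is `m!` times the coefficient of `X^m` in `f`. -/
def tensorCoeff {n : ℕ} {R : Type*} [CommRing R] (f : MvPowerSeries (Fin n) R)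
    (m : Fin n →₀ ℕ) : R :=
  (∏ j, ((m j).factorial : R)) * MvPowerSeries.coeff m f

/-- The matrix `A = (F^{[1]}_{i,j})` of the linear part of `F`. -/
def linMatrix {n : ℕ} {R : Type*} [CommRing R] (F : Fin n → MvPowerSeries (Fin n) R) :
    Matrix (Fin n) (Fin n) R :=
  Matrix.of fun i j => tensorCoeff (F i) (Finsupp.single j 1)

/-- The series `H_i`, minus the sum of the terms of degree at least `2` of `F_i`. -/
def nonlin {n : ℕ} {R : Type*} [CommRing R] (F : Fin n → MvPowerSeries (Fin n) R) (i : Fin n) :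
    MvPowerSeries (Fin n) R :=
  fun m => if 2 ≤ m.degree then -MvPowerSeries.coeff m (F i) else 0

/-- Summability of a family of formal power series, the ring of coefficients being discrete:
every coefficient receives finitely many nonzero contributions. -/
def SummableFamily {σ R ι : Type*} [CommRing R] (f : ι → MvPowerSeries σ R) : Prop :=
  ∀ d : σ →₀ ℕ, {k : ι | MvPowerSeries.coeff d (f k) ≠ 0}.Finite

/-- The sum of a summable family of formal power series. -/
def familySum {σ R ι : Type*} [CommRing R] (f : ι → MvPowerSeries σ R) : MvPowerSeries σ R :=
  fun d => ∑ᶠ k, MvPowerSeries.coeff d (f k)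

/-! ### Formal Gaussian integration -/

/-- The `3n` indeterminates `ū₁,…,ūₙ`, `u₁,…,uₙ`, `Y₁,…,Yₙ`. -/
abbrev FieldVar (n : ℕ) : Type := Fin n ⊕ Fin n ⊕ Fin n

/-- The index of `ū_i`. -/
abbrev ubarVar {n : ℕ} (i : Fin n) : FieldVar n := Sum.inl i

/-- The index of `u_i`. -/
abbrev uVar {n : ℕ} (i : Fin n) : FieldVar n := Sum.inr (Sum.inl i)

/-- The index of `Y_i`. -/
abbrev yVar {n : ℕ} (i : Fin n) : FieldVar n := Sum.inr (Sum.inr i)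

/-- `I_A(τ₁,τ₂) = ∑_σ ∏_k (A⁻¹)_{τ₂(σ(k)) τ₁(k)}`, the sum over all bijections `σ : K₁ → K₂`. -/
def wickSum {n : ℕ} {R : Type*} [CommRing R] (A : Matrix (Fin n) (Fin n) R)
    {K₁ K₂ : Type*} [Fintype K₁] [DecidableEq K₁] [Fintype K₂] [DecidableEq K₂]
    (τ₁ : K₁ → Fin n) (τ₂ : K₂ → Fin n) : R :=
  ∑ σ : K₁ ≃ K₂, ∏ k, A⁻¹ (τ₂ (σ k)) (τ₁ k)

/-- The formal Gaussian integral of the monomial `ū^{α₁} u^{α₂}`, computed with the index maps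
`Sigma.fst : (Σ j, Fin (α j)) → [n]`, whose multiplicity multiindex is `α`. -/
def gaussMonomial {n : ℕ} {R : Type*} [CommRing R] (A : Matrix (Fin n) (Fin n) R)
    (α₁ α₂ : Fin n → ℕ) : R :=
  Ring.inverse A.det *
    wickSum A (Sigma.fst : (Σ j, Fin (α₁ j)) → Fin n) (Sigma.fst : (Σ j, Fin (α₂ j)) → Fin n)

theorem mult_apply {n : ℕ} {K : Type*} [Fintype K] (τ : K → Fin n) (j : Fin n) :
    mult τ j = Fintype.card {k // τ k = j} := by
  classical
  simp [mult, Finsupp.finsetSum_apply, Finsupp.single_apply, Fintype.card_subtype]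

theorem exists_equiv_of_mult {n : ℕ} {K : Type*} [Fintype K] (τ : K → Fin n) (α : Fin n → ℕ)
    (h : ∀ j, mult τ j = α j) : ∃ e : (Σ j, Fin (α j)) ≃ K, ∀ x, τ (e x) = x.1 := by
  classical
  have e : ∀ j, Fin (α j) ≃ {k // τ k = j} := fun j =>
    Fintype.equivOfCardEq (by rw [← mult_apply, h j, Fintype.card_fin])
  refine ⟨(Equiv.sigmaCongrRight e).trans (Equiv.sigmaFiberEquiv τ), fun x => ?_⟩
  exact (e x.1 x.2).2

/-- Any index maps with the right multiplicities compute the same integral. -/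
theorem gaussMonomial_eq {n : ℕ} {R : Type*} [CommRing R] (A : Matrix (Fin n) (Fin n) R)
    (α₁ α₂ : Fin n → ℕ) {K₁ K₂ : Type*} [Fintype K₁] [DecidableEq K₁] [Fintype K₂]
    [DecidableEq K₂] (τ₁ : K₁ → Fin n) (τ₂ : K₂ → Fin n)
    (h₁ : ∀ j, mult τ₁ j = α₁ j) (h₂ : ∀ j, mult τ₂ j = α₂ j) :
    gaussMonomial A α₁ α₂ = Ring.inverse A.det * wickSum A τ₁ τ₂ := by
  obtain ⟨e₁, he₁⟩ := exists_equiv_of_mult τ₁ α₁ h₁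
  obtain ⟨e₂, he₂⟩ := exists_equiv_of_mult τ₂ α₂ h₂
  unfold gaussMonomial wickSum
  congr 1
  refine Fintype.sum_equiv (Equiv.equivCongr e₁ e₂) _ _ fun σ => ?_
  refine Fintype.prod_equiv e₁ _ _ fun x => ?_
  simp [he₁, he₂]

/-- The terms of the formal Gaussian integral of `U ∈ R[[ū,u,Y]]`, one for each monomial
`ū^{α₁} u^{α₂} Y^{α₃}`, as elements of `R[[Y]]`. -/
def gaussTerm {n : ℕ} {R : Type*} [CommRing R] (A : Matrix (Fin n) (Fin n) R)
    (U : MvPowerSeries (FieldVar n) R) (d : FieldVar n →₀ ℕ) : MvPowerSeries (Fin n) R :=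
  MvPowerSeries.monomial (Finsupp.equivFunOnFinite.symm fun j => d (yVar j))
    (MvPowerSeries.coeff d U * gaussMonomial A (fun j => d (ubarVar j)) (fun j => d (uVar j)))

/-- The formal Gaussian integral of `U` is defined. -/
def GaussIntegrable {n : ℕ} {R : Type*} [CommRing R] (A : Matrix (Fin n) (Fin n) R)
    (U : MvPowerSeries (FieldVar n) R) : Prop :=
  SummableFamily (gaussTerm A U)

/-- The formal Gaussian integral `∫ dū du e^{-ūAu} U ∈ R[[Y]]`. -/
def gaussIntegral {n : ℕ} {R : Type*} [CommRing R] (A : Matrix (Fin n) (Fin n) R)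
    (U : MvPowerSeries (FieldVar n) R) : MvPowerSeries (Fin n) R :=
  familySum (gaussTerm A U)

/-- The interaction `ūH(u) + ūY`. -/
def interaction {n : ℕ} {R : Type*} [CommRing R] (F : Fin n → MvPowerSeries (Fin n) R) :
    MvPowerSeries (FieldVar n) R :=
  ∑ i, MvPowerSeries.X (ubarVar i) * MvPowerSeries.rename uVar (nonlin F i) +
    ∑ i, MvPowerSeries.X (ubarVar i) * MvPowerSeries.X (yVar i)

/-- The series `exp(ūH(u) + ūY)`. -/
def expInteraction {n : ℕ} {R : Type*} [CommRing R] [Algebra ℚ R]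
    (F : Fin n → MvPowerSeries (Fin n) R) : MvPowerSeries (FieldVar n) R :=
  (PowerSeries.exp R).subst (interaction F)

/-! ### Feynman diagrams -/

/-- A pre-Feynman diagram structure of type `(I,J)` on the finite set `E`. -/
structure PreFeynman (I J E : Type*) [Fintype E] [DecidableEq E] where
  Eubar : Finset E
  Eu : Finset E
  Eint : Finset E
  Eext : Finset E
  piH : Finset (Finset E)
  piY : Finset (Finset E)
  rhoU : I → E
  rhoUbar : J → E
  isCompl_u_ubar : IsCompl Eu Eubar
  isCompl_int_ext : IsCompl Eint Eext
  bijOn_rhoU : Set.BijOn rhoU Set.univ (Eext ∩ Eu : Finset E)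
  bijOn_rhoUbar : Set.BijOn rhoUbar Set.univ (Eext ∩ Eubar : Finset E)
  disjoint_H_Y : Disjoint piH piY
  partition_int : ∃ P : Finpartition Eint, P.parts = piH ∪ piY
  H_vertex : ∀ B ∈ piH, (B ∩ Eubar).card = 1 ∧ 2 ≤ (B ∩ Eu).card
  Y_vertex : ∀ B ∈ piY, (B ∩ Eubar).card = 1 ∧ B ∩ Eu = ∅

/-- A Feynman diagram structure of type `(I,J)` on `E`: a pre-Feynman diagram structure with a
contraction scheme, a bijection from `E_ū` to `E_u`. -/
structure Feynman (I J E : Type*) [Fintype E] [DecidableEq E] extends PreFeynman I J E where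
  contr : {x // x ∈ Eubar} ≃ {x // x ∈ Eu}

namespace Feynman

section Iso

variable {I J E E' E'' : Type*} [Fintype E] [DecidableEq E] [Fintype E'] [DecidableEq E']
  [Fintype E''] [DecidableEq E'']

/-- The bijection `σ : E → E'` transports the Feynman diagram structure `D` on `E` to the
structure `D'` on `E'`. -/
structure IsIso (D : Feynman I J E) (D' : Feynman I J E') (σ : E ≃ E') : Prop where
  Eubar : D'.Eubar = D.Eubar.map σ.toEmbedding
  Eu : D'.Eu = D.Eu.map σ.toEmbedding
  Eint : D'.Eint = D.Eint.map σ.toEmbedding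
  Eext : D'.Eext = D.Eext.map σ.toEmbedding
  piH : D'.piH = D.piH.map σ.finsetCongr.toEmbedding
  piY : D'.piY = D.piY.map σ.finsetCongr.toEmbedding
  rhoU : D'.rhoU = σ ∘ D.rhoU
  rhoUbar : D'.rhoUbar = σ ∘ D.rhoUbar
  contr : ∀ (x : {x // x ∈ D.Eubar}) (y : {y // y ∈ D'.Eubar}), σ x = y →
    (D'.contr y : E') = σ (D.contr x)

/-- The cardinal of the automorphism group of a Feynman diagram. -/
def autCard (D : Feynman I J E) : ℕ := Nat.card {σ : E ≃ E // D.IsIso D σ}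

theorem IsIso.refl (D : Feynman I J E) : D.IsIso D (Equiv.refl E) := by
  constructor <;> try (ext; simp)
  intro x y h
  obtain rfl : x = y := Subtype.ext h
  rfl

theorem IsIso.symm {D : Feynman I J E} {D' : Feynman I J E'} {σ : E ≃ E'}
    (h : D.IsIso D' σ) : D'.IsIso D σ.symm := by
  constructor
  · rw [h.Eubar]; ext; simp
  · rw [h.Eu]; ext; simp
  · rw [h.Eint]; ext; simp
  · rw [h.Eext]; ext; simp
  · rw [h.piH, Finset.map_map]; ext; simp [Finset.map_map]
  · rw [h.piY, Finset.map_map]; ext; simp [Finset.map_map]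
  · rw [h.rhoU]; ext; simp
  · rw [h.rhoUbar]; ext; simp
  · intro x y hxy
    rw [h.contr y x (by rw [← hxy]; simp)]
    simp

theorem IsIso.trans {D : Feynman I J E} {D' : Feynman I J E'} {D'' : Feynman I J E''}
    {σ : E ≃ E'} {σ' : E' ≃ E''} (h : D.IsIso D' σ) (h' : D'.IsIso D'' σ') :
    D.IsIso D'' (σ.trans σ') := by
  constructor
  · rw [h'.Eubar, h.Eubar, Finset.map_map]; rfl
  · rw [h'.Eu, h.Eu, Finset.map_map]; rfl
  · rw [h'.Eint, h.Eint, Finset.map_map]; rfl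
  · rw [h'.Eext, h.Eext, Finset.map_map]; rfl
  · rw [h'.piH, h.piH, Finset.map_map]
    congr 1; ext s x; simp [Finset.mem_map_equiv, ← Equiv.eq_symm_apply]
  · rw [h'.piY, h.piY, Finset.map_map]
    congr 1; ext s x; simp [Finset.mem_map_equiv, ← Equiv.eq_symm_apply]
  · rw [h'.rhoU, h.rhoU]; rfl
  · rw [h'.rhoUbar, h.rhoUbar]; rfl
  · intro x y hxy
    have hx : σ x ∈ D'.Eubar := by rw [h.Eubar]; simp
    rw [h'.contr ⟨σ x, hx⟩ y hxy, h.contr x ⟨σ x, hx⟩ rfl]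
    rfl

theorem IsIso.autCard_eq {D : Feynman I J E} {D' : Feynman I J E'} {σ : E ≃ E'}
    (h : D.IsIso D' σ) : D.autCard = D'.autCard := by
  refine Nat.card_congr
    { toFun := fun s => ⟨(σ.symm.trans s.1).trans σ, (h.symm.trans s.2).trans h⟩
      invFun := fun s => ⟨(σ.trans s.1).trans σ.symm, (h.trans s.2).trans h.symm⟩
      left_inv := fun s => by ext; simp
      right_inv := fun s => by ext; simp }

end Iso

section Amplitude

variable {I J E E' : Type*} [Fintype E] [DecidableEq E] [Fintype E'] [DecidableEq E']
  {n : ℕ} {R : Type*} [CommRing R]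

/-- The contribution `H(B,α) = H^{[p]}_{α(x̄),α(y₁)…α(y_p)}` of an `H`-vertex `B`, where
`B ∩ E_ū = {x̄}` and `B ∩ E_u = {y₁,…,y_p}` (the product has this single factor). -/
def hVertex (F : Fin n → MvPowerSeries (Fin n) R) (D : Feynman I J E) (α : E → Fin n)
    (B : Finset E) : R :=
  ∏ x ∈ B ∩ D.Eubar, tensorCoeff (nonlin F (α x)) (∑ y ∈ B ∩ D.Eu, Finsupp.single (α y) 1)

/-- The contribution `Y(B,α) = Y_{α(x̄)}` of a `Y`-vertex `B = {x̄}`. -/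
def yVertex (R : Type*) [CommRing R] (D : Feynman I J E) (α : E → Fin n)
    (B : Finset E) : MvPowerSeries (Fin n) R :=
  ∏ x ∈ B ∩ D.Eubar, MvPowerSeries.X (α x)

/-- Index attributions compatible with the index assignments of the external half-lines. -/
def IsAttribution (D : Feynman I J E) (τu : I → Fin n) (τubar : J → Fin n)
    (α : E → Fin n) : Prop :=
  (∀ i, α (D.rhoU i) = τu i) ∧ ∀ j, α (D.rhoUbar j) = τubar j

open Classical in
/-- The amplitude of a Feynman diagram in `R[[Y]]`, with propagators `(A⁻¹)_{α(𝒞(x̄)) α(x̄)}`. -/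
def amplitude (F : Fin n → MvPowerSeries (Fin n) R) (D : Feynman I J E)
    (τu : I → Fin n) (τubar : J → Fin n) : MvPowerSeries (Fin n) R :=
  ∑ α : E → Fin n with D.IsAttribution τu τubar α,
    (∏ x : {x // x ∈ D.Eubar}, MvPowerSeries.C ((linMatrix F)⁻¹ (α (D.contr x)) (α x))) *
      (∏ B ∈ D.piH, MvPowerSeries.C (D.hVertex F α B)) * ∏ B ∈ D.piY, D.yVertex R α B

theorem IsIso.amplitude_eq {D : Feynman I J E} {D' : Feynman I J E'} {σ : E ≃ E'}
    (h : D.IsIso D' σ) (F : Fin n → MvPowerSeries (Fin n) R) (τu : I → Fin n)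
    (τubar : J → Fin n) : D.amplitude F τu τubar = D'.amplitude F τu τubar := by
  classical
  unfold amplitude
  refine Finset.sum_equiv (Equiv.arrowCongr σ (Equiv.refl _)) ?_ ?_
  · intro α
    rw [Finset.mem_filter, Finset.mem_filter]
    simp [IsAttribution, h.rhoU, h.rhoUbar]
  · intro α _
    congr 1
    · congr 1
      · refine Fintype.prod_equiv (σ.subtypeEquiv (by intro a; rw [h.Eubar]; simp)) _ _ ?_
        intro x
        rw [h.contr x (σ.subtypeEquiv _ x) rfl]
        simp
      · rw [h.piH, Finset.prod_map]
        refine Finset.prod_congr rfl fun B _ => ?_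
        simp [hVertex, h.Eubar, h.Eu, ← Finset.map_inter]
    · rw [h.piY, Finset.prod_map]
      refine Finset.prod_congr rfl fun B _ => ?_
      simp [yVertex, h.Eubar, ← Finset.map_inter]

end Amplitude

/-! ### The digraph of a Feynman diagram, connectedness, tree-likeness -/

section Graph

variable {I J E : Type*} [Fintype E] [DecidableEq E]

/-- The `u`-sources, as one-element subsets of `E`. -/
def uSources (D : Feynman I J E) : Finset (Finset E) := (D.Eext ∩ D.Eu).image fun x => {x}

/-- The `ū`-sources, as one-element subsets of `E`. -/
def ubarSources (D : Feynman I J E) : Finset (Finset E) := (D.Eext ∩ D.Eubar).image fun x => {x}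

/-- The vertex set `Ẽ`: sources, `H`-vertices and `Y`-vertices. -/
abbrev Vertex (D : Feynman I J E) : Type _ :=
  {a : Finset E // a ∈ D.uSources ∪ D.ubarSources ∪ D.piH ∪ D.piY}

/-- The digraph `G` on `Ẽ`: a link goes from `a` to `b` if some `x ∈ a ∩ E_ū` is contracted with
an element of `b ∩ E_u`. -/
def digraph (D : Feynman I J E) : Digraph D.Vertex where
  Adj a b := ∃ x : {x // x ∈ D.Eubar}, (x : E) ∈ a.1 ∧ (D.contr x : E) ∈ b.1

/-- The underlying undirected graph of the digraph `G`. -/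
def graph (D : Feynman I J E) : SimpleGraph D.Vertex := D.digraph.toSimpleGraphInclusive

/-- Connected Feynman diagrams: `G` connects `Ẽ`, which is nonempty. -/
def Connected (D : Feynman I J E) : Prop := D.graph.Connected

/-- Tree-like connected Feynman diagrams: `G` is a tree with all links oriented towards the root,
which is the unique `u`-source; the leaves are `Y`-vertices or `ū`-sources; the internal vertices
are `H`-vertices and have at least two offsprings. -/
def TreeLike (D : Feynman I J E) : Prop :=
  ∃ r : D.Vertex,
    (∀ a : D.Vertex, a.1 ∈ D.uSources ↔ a = r) ∧
    D.graph.IsTree ∧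
    (∀ a b, D.digraph.Adj a b → D.graph.dist a r = D.graph.dist b r + 1) ∧
    (∀ a, a ≠ r → (∀ b, ¬ D.digraph.Adj b a) → a.1 ∈ D.piY ∪ D.ubarSources) ∧
    (∀ a, a ≠ r → (∃ b, D.digraph.Adj b a) →
      a.1 ∈ D.piH ∧ ∃ b b', b ≠ b' ∧ D.digraph.Adj b a ∧ D.digraph.Adj b' a)

/-- All leaves (vertices at which no link ends) are `Y`-vertices. -/
def LeavesAreY (D : Feynman I J E) : Prop :=
  ∀ a : D.Vertex, (∀ b, ¬ D.digraph.Adj b a) → a.1 ∈ D.piY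

end Graph

end Feynman

/-! ### Connected correlation functions -/

/-- Connected Feynman diagrams of type `(I,J)` on the standard finite sets. -/
abbrev ConnDiagram (I J : Type*) : Type _ := Σ m : ℕ, {D : Feynman I J (Fin m) // D.Connected}

/-- Isomorphism of connected Feynman diagrams. -/
instance connSetoid (I J : Type*) : Setoid (ConnDiagram I J) where
  r D D' := ∃ σ : Fin D.1 ≃ Fin D'.1, D.2.1.IsIso D'.2.1 σ
  iseqv :=
    { refl := fun D => ⟨_, Feynman.IsIso.refl D.2.1⟩
      symm := fun ⟨_, h⟩ => ⟨_, h.symm⟩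
      trans := fun ⟨_, h⟩ ⟨_, h'⟩ => ⟨_, h.trans h'⟩ }

/-- Isomorphism classes `[E,𝓕]` of connected Feynman diagrams of type `(I,J)`; every finite set `E`
being in bijection with some `Fin m`, each class has representatives on the latter. -/
abbrev ConnClass (I J : Type*) : Type _ := Quotient (connSetoid I J)

/-- The contribution `𝓐(E,𝓕) / #Aut(E,𝓕)` of a class of connected diagrams. -/
def connTerm {n : ℕ} {R : Type*} [CommRing R] [Algebra ℚ R] {I J : Type*}
    (F : Fin n → MvPowerSeries (Fin n) R) (τu : I → Fin n) (τubar : J → Fin n) :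
    ConnClass I J → MvPowerSeries (Fin n) R :=
  Quotient.lift
    (fun D : ConnDiagram I J => (D.2.1.autCard : ℚ)⁻¹ • D.2.1.amplitude F τu τubar)
    (by
      rintro D D' ⟨σ, h⟩
      simp only [h.autCard_eq, h.amplitude_eq])

/-- The connected correlation function `⟨∏ u_{τ_u(i)} ∏ ū_{τ_ū(j)}⟩_C`. -/
def connCorrelation {n : ℕ} {R : Type*} [CommRing R] [Algebra ℚ R] {I J : Type*}
    (F : Fin n → MvPowerSeries (Fin n) R) (τu : I → Fin n) (τubar : J → Fin n) :
    MvPowerSeries (Fin n) R :=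
  familySum (connTerm F τu τubar)

end FeynRev

end

noncomputable section

namespace FeynRev

open MvPowerSeries
open scoped MvPowerSeries.WithPiTopology

/-! ### Summable families and the product topology -/

section Topology

variable {σ R : Type*} [CommRing R] [UniformSpace R] [DiscreteUniformity R]

/-! Both sides equal the `i`-th component `G_i` of the unique constant-term-free solution of `G =
A⁻¹(Y + H(G))`, that is, of the compositional inverse of `F`.

The integral side. Let `Ψ(m)` be the Gaussian integral of `u^m exp(ūH(u) + ūY)`. Contracting one
extra factor `u_i` with every available `ū_l` amounts to differentiating in `ū_l`
(`gaussMonomial_add_single`). As `∂/∂ū_l` multiplies the exponential by `H_l(u) + Y_l`, this gives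
the Schwinger–Dyson equations `Ψ(m + e_i) = ∑_l (A⁻¹)_{il} (Y_l Ψ(m) + ∑_k h_{l,k} Ψ(m + k))`, with
`h_{l,k}` the coefficients of `H_l` (`moment_add_single`). Since `H` has no term of degree below 2
and `Ψ(m)` vanishes in degrees below `|m|`, these equations determine all `Ψ(m)` from `Ψ(0)`
(`SchwingerDyson.eq_of_zero_eq`). The family `G^m Ψ(0)` also solves them, so `Ψ(e_i) = G_i Ψ(0)`
(`moment_single_eq`). The constant term of `Ψ(0)` is `(det A)⁻¹`, so the division is legitimate.

The diagram side. Without `ū`-sources, each vertex other than the `u`-source owns exactly one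
`ū`-half-line, hence has exactly one outgoing link. A diagram is therefore a parent map `V → Option
V`, with `none` the `u`-source (`isPres_parent`). It is connected exactly when iterating the map
always reaches `none`, and it is then a rooted tree whose symmetries are those of the diagram
(`IsPres.card_isIso`).

The bridge. Planar trees, weighted by `∏ 1/d!` over the vertices (`d` the number of children), have
a total amplitude that satisfies the equation for `G`, by splitting at the root (`treeSeries_eq`).
For a fixed rooted tree, the sum over planar trees `t` of the weight of `t` times the number of
isomorphisms from `t` is 1 (`hasSum_weight_mul_card_covering`). The number of isomorphisms is `#Aut`
or 0, so the planar trees of one class have total weight `1/#Aut` (`hasSum_fiber`). -/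

theorem summableFamily_iff_summable {ι : Type*} (f : ι → MvPowerSeries σ R) :
    SummableFamily f ↔ Summable f := by
  rw [WithPiTopology.summable_iff_summable_coeff]
  refine forall_congr' fun d => ⟨fun h => ?_, fun h => ?_⟩
  · exact summable_of_hasFiniteSupport h
  · exact h.hasFiniteSupport_of_discreteTopology

theorem summableFamily_of_hasSum {ι : Type*} {f : ι → MvPowerSeries σ R} {a : MvPowerSeries σ R}
    (h : HasSum f a) : SummableFamily f :=
  (summableFamily_iff_summable f).2 h.summable

theorem familySum_eq_of_hasSum {ι : Type*} {f : ι → MvPowerSeries σ R} {a : MvPowerSeries σ R}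
    (h : HasSum f a) : familySum f = a := by
  ext d
  have hd := (WithPiTopology.hasSum_iff_hasSum_coeff.1 h) d
  have hs := summableFamily_of_hasSum h d
  rw [← hd.tsum_eq, tsum_eq_finsum hs]
  rfl

/-- This allows products of unconditional sums to be expanded without any absolute convergence. -/
instance nonarchimedeanRing_mvPowerSeries : NonarchimedeanRing (MvPowerSeries σ R) where
  is_nonarchimedean U hU := by
    obtain ⟨I, hI, hIU⟩ := (IsLinearTopology.hasBasis_open_ideal
      (R := MvPowerSeries σ R)).mem_iff.1 hU
    exact ⟨⟨I.toAddSubgroup, hI⟩, hIU⟩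

theorem hasSum_pi_prod {T : Type*} [CommRing T] [UniformSpace T] [IsUniformAddGroup T]
    [NonarchimedeanRing T] {ι : Type*} :
    ∀ {d : ℕ} {f : Fin d → ι → T} {a : Fin d → T}, (∀ k, HasSum (f k) (a k)) →
      HasSum (fun c : Fin d → ι => ∏ k, f k (c k)) (∏ k, a k) := by
  intro d
  induction d with
  | zero =>
    intro f a _
    simp
  | succ d ih =>
    intro f a h
    have h1 := (h 0).mul_of_nonarchimedean (ih fun k => h k.succ)
    rw [Fin.prod_univ_succ, ← (Fin.consEquiv fun _ => ι).hasSum_iff]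
    convert h1 using 1
    ext p
    simp [Fin.prod_univ_succ, Fin.consEquiv]

end Topology

/-! ### Wick's recursion -/

section Wick

variable {n : ℕ} {R : Type*} [CommRing R] (A : Matrix (Fin n) (Fin n) R)

theorem wickSum_option {K₁ K₂ : Type*} [Fintype K₁] [DecidableEq K₁] [Fintype K₂]
    [DecidableEq K₂] (τ₁ : K₁ → Fin n) (τ₂ : K₂ → Fin n) (i : Fin n) :
    wickSum A τ₁ (fun o : Option K₂ => o.elim i τ₂) =
      ∑ k : K₁, A⁻¹ i (τ₁ k) * wickSum A (fun x : {x // x ≠ k} => τ₁ x) τ₂ := by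
  have h1 : wickSum A τ₁ (fun o : Option K₂ => o.elim i τ₂) =
      ∑ e : Option K₂ ≃ K₁, ∏ o : Option K₂, A⁻¹ (o.elim i τ₂) (τ₁ (e o)) := by
    refine Fintype.sum_equiv ⟨Equiv.symm, Equiv.symm, fun _ => rfl, fun _ => rfl⟩ _ _ fun e => ?_
    exact Fintype.prod_equiv e _ _ fun k => by simp
  rw [h1, ← Fintype.sum_fiberwise (g := fun e : Option K₂ ≃ K₁ => e none)]
  refine Finset.sum_congr rfl fun k _ => ?_
  rw [wickSum, Finset.mul_sum]
  refine Fintype.sum_equiv ((Equiv.optionSubtype k).trans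
    ⟨Equiv.symm, Equiv.symm, fun _ => rfl, fun _ => rfl⟩) _ _ fun e => ?_
  rw [Fintype.prod_option, Option.elim_none, e.2]
  congr 1
  refine Fintype.prod_equiv (Equiv.optionSubtype k e) _ _ fun o => ?_
  simp

theorem mult_subtype_ne {K : Type*} [Fintype K] [DecidableEq K] (τ : K → Fin n) (k : K) :
    mult (fun x : {x // x ≠ k} => τ x) + Finsupp.single (τ k) 1 = mult τ := by
  rw [mult, mult, ← Fintype.sum_subtype_add_sum_subtype (fun x => x = k), add_comm]
  congr 1
  convert (Finset.sum_eq_single_of_mem (f := fun x : {x // x = k} => Finsupp.single (τ x) 1)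
    ⟨k, rfl⟩ (Finset.mem_univ _) fun x _ hx => absurd (Subtype.ext x.2) hx).symm

theorem mult_sigma_fst (α : Fin n → ℕ) (j : Fin n) :
    mult (Sigma.fst : (Σ j, Fin (α j)) → Fin n) j = α j := by
  simp [mult, Finsupp.finsetSum_apply, Fintype.sum_sigma, Finsupp.single_apply]

/-- Gaussian integration by parts. The added `u_i` is paired with one of the `α l` copies of `ū_l`,
and all copies contribute equally. The truncated subtraction is harmless because the factor `α l`
vanishes exactly when it truncates. -/
theorem gaussMonomial_add_single (α β : Fin n →₀ ℕ) (i : Fin n) :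
    gaussMonomial A α (β + Finsupp.single i 1 : Fin n →₀ ℕ) =
      ∑ l, A⁻¹ i l * (α l * gaussMonomial A (α - Finsupp.single l 1 : Fin n →₀ ℕ) β) := by
  have hβ : ∀ j, mult (fun o : Option (Σ j, Fin (β j)) => o.elim i Sigma.fst) j =
      (β + Finsupp.single i 1 : Fin n →₀ ℕ) j := by
    intro j
    rw [mult, Fintype.sum_option, add_comm]
    have := mult_sigma_fst (⇑β) j
    rw [mult] at this
    rw [Finsupp.add_apply, Finsupp.add_apply, ← this]
    rfl
  rw [gaussMonomial_eq A _ _ (Sigma.fst : (Σ j, Fin (α j)) → Fin n) _ (mult_sigma_fst _) hβ,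
    wickSum_option, Fintype.sum_sigma, Finset.mul_sum]
  refine Finset.sum_congr rfl fun l _ => ?_
  rw [Finset.mul_sum, Finset.sum_congr rfl (g := fun _ => A⁻¹ i l *
    gaussMonomial A (α - Finsupp.single l 1 : Fin n →₀ ℕ) β) ?_]
  · simp; ring
  · intro k _
    rw [gaussMonomial_eq A _ _ (fun x : {x : (Σ j, Fin (α j)) // x ≠ ⟨l, k⟩} => x.1.1)
      (Sigma.fst : (Σ j, Fin (β j)) → Fin n) ?_ (mult_sigma_fst _)]
    · ring
    · intro j
      have := congrArg (· j) (mult_subtype_ne (Sigma.fst : (Σ j, Fin (α j)) → Fin n) ⟨l, k⟩)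
      simp only [Finsupp.add_apply, mult_sigma_fst] at this
      simp only [Finsupp.tsub_apply, ← this, add_tsub_cancel_right]

theorem gaussMonomial_eq_zero {α β : Fin n →₀ ℕ} (h : α.degree ≠ β.degree) :
    gaussMonomial A α β = 0 := by
  have : IsEmpty ((Σ j, Fin (α j)) ≃ (Σ j, Fin (β j))) := by
    refine ⟨fun e => h ?_⟩
    simpa [Finsupp.degree_eq_sum] using Fintype.card_congr e
  rw [gaussMonomial, wickSum, Fintype.sum_empty, mul_zero]

theorem gaussMonomial_zero_zero :
    gaussMonomial A (0 : Fin n →₀ ℕ) (0 : Fin n →₀ ℕ) = Ring.inverse A.det := by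
  have h : IsEmpty (Σ j, Fin ((0 : Fin n →₀ ℕ) j)) := ⟨fun x => Fin.elim0 x.2⟩
  rw [gaussMonomial, wickSum, Fintype.sum_unique, Fintype.prod_empty, mul_one]

end Wick

/-! ### The series `exp(ūH(u) + ūY)` -/

section Interaction

variable {n : ℕ}

/-- The multiindex of the `ū`-variables. -/
def ubarPart (d : FieldVar n →₀ ℕ) : Fin n →₀ ℕ :=
  Finsupp.equivFunOnFinite.symm fun j => d (ubarVar j)

/-- The multiindex of the `u`-variables. -/
def uPart (d : FieldVar n →₀ ℕ) : Fin n →₀ ℕ := Finsupp.equivFunOnFinite.symm fun j => d (uVar j)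

/-- The multiindex of the `Y`-variables. -/
def yPart (d : FieldVar n →₀ ℕ) : Fin n →₀ ℕ := Finsupp.equivFunOnFinite.symm fun j => d (yVar j)

@[simp] theorem ubarPart_apply (d : FieldVar n →₀ ℕ) (j : Fin n) :
    ubarPart d j = d (ubarVar j) := rfl

@[simp] theorem uPart_apply (d : FieldVar n →₀ ℕ) (j : Fin n) : uPart d j = d (uVar j) := rfl

@[simp] theorem yPart_apply (d : FieldVar n →₀ ℕ) (j : Fin n) : yPart d j = d (yVar j) := rfl

theorem ubarPart_add (d e : FieldVar n →₀ ℕ) : ubarPart (d + e) = ubarPart d + ubarPart e := by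
  ext; simp

theorem uPart_add (d e : FieldVar n →₀ ℕ) : uPart (d + e) = uPart d + uPart e := by
  ext; simp

theorem yPart_add (d e : FieldVar n →₀ ℕ) : yPart (d + e) = yPart d + yPart e := by
  ext; simp

@[simp] theorem ubarPart_single_ubar (l : Fin n) (k : ℕ) :
    ubarPart (Finsupp.single (ubarVar l) k) = Finsupp.single l k := by
  ext; simp [Finsupp.single_apply]

@[simp] theorem ubarPart_single_u (l : Fin n) (k : ℕ) :
    ubarPart (Finsupp.single (uVar l) k) = 0 := by
  ext; simp

@[simp] theorem ubarPart_single_y (l : Fin n) (k : ℕ) :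
    ubarPart (Finsupp.single (yVar l) k) = 0 := by
  ext; simp

@[simp] theorem uPart_single_ubar (l : Fin n) (k : ℕ) :
    uPart (Finsupp.single (ubarVar l) k) = 0 := by
  ext; simp

@[simp] theorem uPart_single_u (l : Fin n) (k : ℕ) :
    uPart (Finsupp.single (uVar l) k) = Finsupp.single l k := by
  ext; simp [Finsupp.single_apply]

@[simp] theorem uPart_single_y (l : Fin n) (k : ℕ) :
    uPart (Finsupp.single (yVar l) k) = 0 := by
  ext; simp

@[simp] theorem yPart_single_ubar (l : Fin n) (k : ℕ) :
    yPart (Finsupp.single (ubarVar l) k) = 0 := by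
  ext; simp

@[simp] theorem yPart_single_u (l : Fin n) (k : ℕ) :
    yPart (Finsupp.single (uVar l) k) = 0 := by
  ext; simp

@[simp] theorem yPart_single_y (l : Fin n) (k : ℕ) :
    yPart (Finsupp.single (yVar l) k) = Finsupp.single l k := by
  ext; simp [Finsupp.single_apply]

/-- The embedding of the `u`-variables. -/
def uEmb : Fin n ↪ FieldVar n := ⟨uVar, fun i j h => by simpa using h⟩

/-- The multiindex `k` in the `u`-variables. -/
def uMonomial (k : Fin n →₀ ℕ) : FieldVar n →₀ ℕ := k.embDomain uEmb

@[simp] theorem ubarPart_uMonomial (k : Fin n →₀ ℕ) : ubarPart (uMonomial k) = 0 := by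
  ext j
  exact Finsupp.embDomain_of_notMem_range _ _ _ (by rintro ⟨x, hx⟩; cases hx)

@[simp] theorem uPart_uMonomial (k : Fin n →₀ ℕ) : uPart (uMonomial k) = k := by
  ext j
  exact Finsupp.embDomain_apply_self uEmb k j

@[simp] theorem yPart_uMonomial (k : Fin n →₀ ℕ) : yPart (uMonomial k) = 0 := by
  ext j
  exact Finsupp.embDomain_of_notMem_range _ _ _ (by rintro ⟨x, hx⟩; cases hx)

theorem field_ext {d e : FieldVar n →₀ ℕ} (h1 : ubarPart d = ubarPart e) (h2 : uPart d = uPart e)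
    (h3 : yPart d = yPart e) : d = e := by
  ext (j | j | j)
  · exact DFunLike.congr_fun h1 j
  · exact DFunLike.congr_fun h2 j
  · exact DFunLike.congr_fun h3 j

variable {R : Type*} [CommRing R] (F : Fin n → MvPowerSeries (Fin n) R)

/-- Power series with exponents in a submonoid form a subring. -/
def supportedSubring {σ : Type*} (R : Type*) [CommRing R] (P : AddSubmonoid (σ →₀ ℕ)) :
    Subring (MvPowerSeries σ R) where
  carrier := {f | ∀ d, coeff d f ≠ 0 → d ∈ P}
  mul_mem' := by
    classical
    intro f g hf hg d hd
    rw [coeff_mul] at hd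
    obtain ⟨p, hp, hne⟩ := Finset.exists_ne_zero_of_sum_ne_zero hd
    rw [← Finset.HasAntidiagonal.mem_antidiagonal.1 hp]
    exact P.add_mem (hf _ (left_ne_zero_of_mul hne)) (hg _ (right_ne_zero_of_mul hne))
  one_mem' := by
    classical
    intro d hd
    rw [coeff_one] at hd
    split_ifs at hd with h
    · exact h ▸ P.zero_mem
    · exact absurd rfl hd
  add_mem' := by
    intro f g hf hg d hd
    by_contra h
    exact hd (by rw [map_add, not_not.1 (mt (hf d) h), not_not.1 (mt (hg d) h), add_zero])
  zero_mem' := by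
    intro d hd
    simp at hd
  neg_mem' := by
    intro f hf d hd
    exact hf d (by simpa using hd)

/-- The exponents that occur in `exp(ūH(u) + ūY)`. -/
def interactionExponents (n : ℕ) : AddSubmonoid (FieldVar n →₀ ℕ) where
  carrier := {d | 2 * (ubarPart d).degree ≤ (uPart d).degree + 2 * (yPart d).degree}
  add_mem' := by
    intro d e hd he
    simp only [Set.mem_ofPred_eq, ubarPart_add, uPart_add, yPart_add, map_add] at *
    omega
  zero_mem' := by
    have : ubarPart (0 : FieldVar n →₀ ℕ) = 0 := by ext; simp
    simp [this]

theorem mem_interactionExponents {d : FieldVar n →₀ ℕ} : d ∈ interactionExponents n ↔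
    2 * (ubarPart d).degree ≤ (uPart d).degree + 2 * (yPart d).degree := Iff.rfl

theorem coeff_nonlin (l : Fin n) (k : Fin n →₀ ℕ) :
    coeff k (nonlin F l) = if 2 ≤ k.degree then -coeff k (F l) else 0 := rfl

theorem two_le_degree_of_coeff_nonlin {l : Fin n} {k : Fin n →₀ ℕ}
    (h : coeff k (nonlin F l) ≠ 0) : 2 ≤ k.degree := by
  by_contra h'
  exact h (by rw [coeff_nonlin, if_neg h'])

theorem coeff_rename_nonlin_ne_zero {l : Fin n} {d : FieldVar n →₀ ℕ}
    (h : coeff d (rename uVar (nonlin F l)) ≠ 0) : ∃ k, d = uMonomial k ∧ 2 ≤ k.degree := by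
  by_cases hd : ∃ k, d = uMonomial k
  · obtain ⟨k, rfl⟩ := hd
    refine ⟨k, rfl, two_le_degree_of_coeff_nonlin F (l := l) ?_⟩
    rwa [← coeff_embDomain_rename uEmb]
  · refine absurd (coeff_rename_eq_zero uVar (nonlin F l) ?_) h
    rintro ⟨k, hk⟩
    exact hd ⟨k, by rw [← hk, uMonomial, Finsupp.embDomain_eq_mapDomain]; rfl⟩

theorem coeff_uMonomial_rename_nonlin (l : Fin n) (k : Fin n →₀ ℕ) :
    coeff (uMonomial k) (rename uVar (nonlin F l)) = coeff k (nonlin F l) :=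
  coeff_embDomain_rename uEmb _ _

/-- A monomial of `ū_l H_l(u)` has degree 1 in `ū` and at least 2 in `u`; a monomial `ū_l Y_l` has
degree 1 in `ū` and in `Y`. Both satisfy the inequality, which is additive and so passes to all
powers and to the exponential. -/
theorem interaction_mem : interaction F ∈ supportedSubring R (interactionExponents n) := by
  classical
  refine add_mem (sum_mem fun l _ => ?_) (sum_mem fun l _ => ?_)
  · intro d hd
    rw [coeff_mul] at hd
    obtain ⟨p, hp, hne⟩ := Finset.exists_ne_zero_of_sum_ne_zero hd
    rw [← Finset.HasAntidiagonal.mem_antidiagonal.1 hp]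
    have h1 := left_ne_zero_of_mul hne
    rw [coeff_X] at h1
    split_ifs at h1 with h1'
    · obtain ⟨k, hk, hk2⟩ := coeff_rename_nonlin_ne_zero F (right_ne_zero_of_mul hne)
      rw [h1', hk, mem_interactionExponents]
      simp only [ubarPart_add, uPart_add, yPart_add, map_add, ubarPart_single_ubar,
        ubarPart_uMonomial, uPart_uMonomial, yPart_uMonomial, uPart_single_ubar,
        yPart_single_ubar, Finsupp.degree_single, map_zero]
      omega
    · exact absurd rfl h1
  · intro d hd
    rw [X, X, monomial_mul_monomial, coeff_monomial] at hd
    split_ifs at hd with h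
    · rw [h, mem_interactionExponents]
      simp [ubarPart_add, uPart_add, yPart_add]
    · exact absurd rfl hd

theorem constantCoeff_interaction : constantCoeff (interaction F) = 0 := by
  simp [interaction]

theorem pderiv_rename_nonlin (l j : Fin n) :
    pderiv R (ubarVar l) (rename uVar (nonlin F j)) = 0 := by
  ext d
  rw [coeff_pderiv, map_zero]
  by_contra h
  obtain ⟨k, hk, -⟩ := coeff_rename_nonlin_ne_zero F (left_ne_zero_of_mul h)
  have := DFunLike.congr_fun (congrArg ubarPart hk) l
  simp at this

theorem pderiv_interaction (l : Fin n) : pderiv R (ubarVar l) (interaction F) =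
    rename uVar (nonlin F l) + X (yVar l) := by
  classical
  simp [interaction, pderiv_rename_nonlin, pderiv_X, Pi.single_apply]

variable [Algebra ℚ R]

theorem coeff_expInteraction_eq (d : FieldVar n →₀ ℕ) : coeff d (expInteraction F) =
    ∑ᶠ k : ℕ, algebraMap ℚ R (1 / k.factorial) * coeff d (interaction F ^ k) := by
  rw [expInteraction, PowerSeries.coeff_subst (.of_constantCoeff_zero (constantCoeff_interaction F))]
  simp

theorem expInteraction_mem :
    expInteraction F ∈ supportedSubring R (interactionExponents n) := by
  intro d hd
  rw [coeff_expInteraction_eq] at hd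
  obtain ⟨k, hk⟩ := not_forall.1 (mt finsum_eq_zero_of_forall_eq_zero hd)
  exact pow_mem (interaction_mem F) k d (right_ne_zero_of_mul hk)

theorem constantCoeff_expInteraction : constantCoeff (expInteraction F) = 1 := by
  rw [← coeff_zero_eq_constantCoeff_apply, coeff_expInteraction_eq, finsum_eq_single _ 0]
  · simp
  · intro k hk
    simp [constantCoeff_interaction, hk]

variable [UniformSpace R]

theorem hasSum_expInteraction :
    HasSum (fun k : ℕ => algebraMap ℚ R (1 / k.factorial) • interaction F ^ k)
      (expInteraction F) := by
  rw [WithPiTopology.hasSum_iff_hasSum_coeff]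
  intro d
  have h := PowerSeries.coeff_subst_finite
    (.of_constantCoeff_zero (constantCoeff_interaction F)) (PowerSeries.exp R) d
  rw [expInteraction,
    PowerSeries.coeff_subst (.of_constantCoeff_zero (constantCoeff_interaction F)),
    ← tsum_eq_finsum h (L := .unconditional ℕ)]
  convert (summable_of_hasFiniteSupport (L := .unconditional ℕ) h).hasSum using 2 with k
  rw [map_smul, PowerSeries.coeff_exp]

variable [DiscreteUniformity R]

/-- Termwise differentiation of the exponential series. This is the only property of the
exponential, besides its support and its constant term, that the moments need. -/
theorem pderiv_expInteraction (l : Fin n) : pderiv R (ubarVar l) (expInteraction F) =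
    (rename uVar (nonlin F l) + X (yVar l)) * expInteraction F := by
  have h1 : HasSum (fun k : ℕ => pderiv R (ubarVar l)
      (algebraMap ℚ R (1 / k.factorial) • interaction F ^ k))
      (pderiv R (ubarVar l) (expInteraction F)) := by
    rw [WithPiTopology.hasSum_iff_hasSum_coeff]
    intro d
    simp only [coeff_pderiv]
    exact ((WithPiTopology.hasSum_iff_hasSum_coeff.1 (hasSum_expInteraction F)) _).mul_right _
  have h2 := (hasSum_expInteraction F).mul_left (rename uVar (nonlin F l) + X (yVar l))
  refine h1.unique ?_
  -- The term of exponent 0 has zero derivative; after dropping it, `(k+1)/(k+1)! = 1/k!` matches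
  -- the two series term by term.
  rw [← hasSum_nat_add_iff' 1, Finset.sum_range_one, pow_zero, Derivation.map_smul,
    Derivation.map_one_eq_zero, smul_zero, sub_zero]
  refine h2.congr_fun fun k => ?_
  rw [Derivation.map_smul, pderiv_pow, pderiv_interaction, Nat.add_sub_cancel,
    Nat.factorial_succ]
  have hk : algebraMap ℚ R (1 / k.factorial) =
      algebraMap ℚ R (1 / ((k + 1) * k.factorial : ℕ)) * ((k + 1 : ℕ) : R) := by
    rw [← map_natCast (algebraMap ℚ R), ← map_mul]
    congr 1
    push_cast
    have : (k.factorial : ℚ) ≠ 0 := by positivity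
    have : (k + 1 : ℚ) ≠ 0 := by positivity
    field_simp
  rw [hk, smul_eq_C_mul, smul_eq_C_mul, map_mul, map_natCast]
  ring

end Interaction

/-! ### Moments of the Gaussian integral -/

section Moments

theorem gaussTerm_eq {n : ℕ} {R : Type*} [CommRing R] (A : Matrix (Fin n) (Fin n) R)
    (U : MvPowerSeries (FieldVar n) R) (d : FieldVar n →₀ ℕ) : gaussTerm A U d =
      monomial (yPart d) (coeff d U * gaussMonomial A (ubarPart d) (uPart d)) := rfl

variable {n : ℕ} {R : Type*} [CommRing R] [Algebra ℚ R]
  (F : Fin n → MvPowerSeries (Fin n) R)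

/-- The terms of the formal Gaussian integral of `u^m exp(ūH(u) + ūY)`. -/
def momentTerm (m : Fin n →₀ ℕ) (d : FieldVar n →₀ ℕ) : MvPowerSeries (Fin n) R :=
  monomial (yPart d) (coeff d (expInteraction F) *
    gaussMonomial (linMatrix F) (ubarPart d) (uPart d + m : Fin n →₀ ℕ))

/-- The formal Gaussian integral of `u^m exp(ūH(u) + ūY)`. -/
def moment (m : Fin n →₀ ℕ) : MvPowerSeries (Fin n) R := familySum (momentTerm F m)

theorem gaussTerm_expInteraction :
    gaussTerm (linMatrix F) (expInteraction F) = momentTerm F 0 := by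
  ext1 d
  rw [gaussTerm_eq, momentTerm, add_zero]

/-- The support of the exponential gives `2|ū| ≤ |u| + 2|Y|`, and Wick pairing forces `|ū| = |u| +
|m|`. Eliminating `|ū|` bounds `|u|` and `|m|` by the degree in `Y`. Every finiteness and vanishing
statement about moments comes from this. -/
theorem bounds_of_coeff_momentTerm_ne_zero {m a : Fin n →₀ ℕ} {d : FieldVar n →₀ ℕ}
    (h : coeff a (momentTerm F m d) ≠ 0) : yPart d = a ∧
      (uPart d).degree + 2 * m.degree ≤ 2 * a.degree ∧
      (ubarPart d).degree = (uPart d).degree + m.degree := by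
  classical
  rw [momentTerm, coeff_monomial] at h
  split_ifs at h with ha
  · have h1 := expInteraction_mem F d (left_ne_zero_of_mul h)
    have h2 := not_not.1 (mt (gaussMonomial_eq_zero (linMatrix F)) (right_ne_zero_of_mul h))
    rw [map_add] at h2
    rw [mem_interactionExponents] at h1
    subst ha
    exact ⟨rfl, by omega, h2⟩
  · exact absurd rfl h

theorem finite_field_of_bounds (b : ℕ) : {d : FieldVar n →₀ ℕ | (ubarPart d).degree ≤ b ∧
    (uPart d).degree ≤ b ∧ (yPart d).degree ≤ b}.Finite := by
  refine (Finsupp.finite_of_degree_le (σ := FieldVar n) (3 * b)).subset ?_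
  rintro d ⟨h1, h2, h3⟩
  have : d.degree = (ubarPart d).degree + ((uPart d).degree + (yPart d).degree) := by
    simp [Finsupp.degree_eq_sum, Fintype.sum_sum_type]
  simp only [Set.mem_ofPred_eq, this]
  omega

theorem momentTerm_summable (m : Fin n →₀ ℕ) : SummableFamily (momentTerm F m) := by
  intro a
  refine (finite_field_of_bounds (2 * a.degree)).subset fun d hd => ?_
  obtain ⟨h1, h2, h3⟩ := bounds_of_coeff_momentTerm_ne_zero F hd
  refine ⟨?_, ?_, ?_⟩ <;> [skip; skip; rw [h1]] <;> omega

theorem coeff_moment_eq_zero {m a : Fin n →₀ ℕ} (h : a.degree < m.degree) :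
    coeff a (moment F m) = 0 := by
  refine finsum_eq_zero_of_forall_eq_zero fun d => ?_
  by_contra hd
  obtain ⟨-, h2, -⟩ := bounds_of_coeff_momentTerm_ne_zero F hd
  omega

/-- For `a = m = 0` the degree bounds leave only the empty monomial, whose integral is `(det A)⁻¹`.
-/
theorem constantCoeff_moment_zero :
    constantCoeff (moment F 0) = Ring.inverse (linMatrix F).det := by
  rw [← coeff_zero_eq_constantCoeff_apply]
  refine (finsum_eq_single _ 0 fun d hd => ?_).trans ?_
  · by_contra h
    obtain ⟨h1, h2, h3⟩ := bounds_of_coeff_momentTerm_ne_zero F h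
    simp only [map_zero, mul_zero, add_zero, nonpos_iff_eq_zero] at h2 h3
    rw [h2, Finsupp.degree_eq_zero_iff] at h3
    rw [Finsupp.degree_eq_zero_iff] at h2
    exact hd (field_ext (by rw [h3]; ext; simp) (by rw [h2]; ext; simp) (by rw [h1]; ext; simp))
  · have h1 : ubarPart (0 : FieldVar n →₀ ℕ) = 0 := by ext; simp
    have h2 : uPart (0 : FieldVar n →₀ ℕ) = 0 := by ext; simp
    have h3 : yPart (0 : FieldVar n →₀ ℕ) = 0 := by ext; simp
    rw [momentTerm, h1, h2, h3, coeff_monomial_same, coeff_zero_eq_constantCoeff_apply,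
      constantCoeff_expInteraction, add_zero, gaussMonomial_zero_zero, one_mul]

theorem isUnit_moment_zero (hA : IsUnit (linMatrix F)) : IsUnit (moment F 0) := by
  rw [isUnit_iff_constantCoeff, constantCoeff_moment_zero]
  exact ((Matrix.isUnit_iff_isUnit_det _).1 hA).ringInverse

variable [UniformSpace R] [DiscreteUniformity R]

theorem hasSum_moment (m : Fin n →₀ ℕ) : HasSum (momentTerm F m) (moment F m) := by
  have h := ((summableFamily_iff_summable _).1 (momentTerm_summable F m)).hasSum
  rwa [moment, familySum_eq_of_hasSum h]

theorem hasSum_gaussTerm_X_mul (i : Fin n) :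
    HasSum (gaussTerm (linMatrix F) (X (uVar i) * expInteraction F))
      (moment F (Finsupp.single i 1)) := by
  classical
  -- Multiplication by `u_i` shifts exponents; those outside the image of the shift have coefficient
  -- zero.
  rw [← Function.Injective.hasSum_iff (add_left_injective (Finsupp.single (uVar i) 1))]
  · refine (hasSum_moment F _).congr_fun fun d => ?_
    simp only [Function.comp]
    rw [gaussTerm_eq, add_comm d, X, coeff_add_monomial_mul, one_mul, yPart_add, ubarPart_add,
      uPart_add, momentTerm, yPart_single_u, ubarPart_single_u, uPart_single_u, zero_add, zero_add,
      add_comm (uPart d)]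
  · intro d hd
    rw [gaussTerm, X, coeff_monomial_mul, if_neg, zero_mul, map_zero]
    exact fun h => hd ⟨d - _, tsub_add_cancel_of_le h⟩

theorem hasSum_X_mul_moment (m : Fin n →₀ ℕ) (l : Fin n) :
    HasSum (fun d => monomial (yPart d) (coeff d (X (yVar l) * expInteraction F) *
      gaussMonomial (linMatrix F) (ubarPart d) (uPart d + m : Fin n →₀ ℕ)))
      (X l * moment F m) := by
  classical
  rw [← Function.Injective.hasSum_iff (add_left_injective (Finsupp.single (yVar l) 1))]
  · refine ((hasSum_moment F m).mul_left (X l)).congr_fun fun d => ?_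
    simp only [Function.comp]
    rw [add_comm d, X, coeff_add_monomial_mul, one_mul, yPart_add, ubarPart_add, uPart_add,
      momentTerm, X, monomial_mul_monomial]
    simp
  · intro d hd
    rw [X, coeff_monomial_mul, if_neg, zero_mul, map_zero]
    exact fun h => hd ⟨d - _, tsub_add_cancel_of_le h⟩

/-- Joint summability over `k` and `d`, which justifies exchanging the expansion of `H` with the
integral: a contribution to `Y^a` requires `|m + k| ≤ |a|`. -/
theorem summable_nonlin_momentTerm (m : Fin n →₀ ℕ) (l : Fin n) :
    Summable fun p : (Fin n →₀ ℕ) × (FieldVar n →₀ ℕ) =>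
      C (coeff p.1 (nonlin F l)) * momentTerm F (m + p.1) p.2 := by
  rw [← summableFamily_iff_summable]
  intro a
  refine ((Finsupp.finite_of_degree_le (σ := Fin n) a.degree).prod
    (finite_field_of_bounds (2 * a.degree))).subset fun p hp => ?_
  rw [Set.mem_ofPred_eq, coeff_C_mul] at hp
  obtain ⟨h1, h2, h3⟩ := bounds_of_coeff_momentTerm_ne_zero F (right_ne_zero_of_mul hp)
  rw [map_add] at h2 h3
  refine ⟨?_, ?_, ?_, ?_⟩ <;> [change p.1.degree ≤ _; skip; skip; rw [h1]] <;> omega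

theorem hasSum_nonlin_moment (m : Fin n →₀ ℕ) (l : Fin n) :
    HasSum (fun k => C (coeff k (nonlin F l)) * moment F (m + k))
      (∑' p : (Fin n →₀ ℕ) × (FieldVar n →₀ ℕ),
        C (coeff p.1 (nonlin F l)) * momentTerm F (m + p.1) p.2) := by
  refine HasSum.prod_fiberwise (summable_nonlin_momentTerm F m l).hasSum fun k => ?_
  exact (hasSum_moment F (m + k)).mul_left (C (coeff k (nonlin F l)))

/-- Inserting `H_l(u)` under the integral. The product is expanded over pairs of exponents; only
first components that are pure `u`-monomials count, and a factor `u^k` turns the moment of `m` into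
that of `m + k`. Grouping the pairs by their sum recovers the coefficients of the product. -/
theorem hasSum_nonlin_mul_expInteraction (m : Fin n →₀ ℕ) (l : Fin n) :
    HasSum (fun d => monomial (yPart d) (coeff d (rename uVar (nonlin F l) * expInteraction F) *
      gaussMonomial (linMatrix F) (ubarPart d) (uPart d + m : Fin n →₀ ℕ)))
      (∑' k, C (coeff k (nonlin F l)) * moment F (m + k)) := by
  classical
  rw [(hasSum_nonlin_moment F m l).tsum_eq]
  have h := (summable_nonlin_momentTerm F m l).hasSum
  let T : (FieldVar n →₀ ℕ) × (FieldVar n →₀ ℕ) → MvPowerSeries (Fin n) R := fun q =>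
    monomial (yPart (q.1 + q.2)) (coeff q.1 (rename uVar (nonlin F l)) *
      coeff q.2 (expInteraction F) * gaussMonomial (linMatrix F) (ubarPart (q.1 + q.2))
        (uPart (q.1 + q.2) + m : Fin n →₀ ℕ))
  have hinj : Function.Injective fun p : (Fin n →₀ ℕ) × (FieldVar n →₀ ℕ) =>
      (uMonomial p.1, p.2) := by
    rintro ⟨k, d⟩ ⟨k', d'⟩ hp
    obtain ⟨h1, rfl⟩ := Prod.mk.inj hp
    rw [← uPart_uMonomial k, h1, uPart_uMonomial]
  have hT : HasSum T (∑' p : (Fin n →₀ ℕ) × (FieldVar n →₀ ℕ),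
      C (coeff p.1 (nonlin F l)) * momentTerm F (m + p.1) p.2) := by
    rw [← hinj.hasSum_iff]
    · refine h.congr_fun fun p => ?_
      simp only [Function.comp, T]
      rw [coeff_uMonomial_rename_nonlin, yPart_add, ubarPart_add, uPart_add, yPart_uMonomial,
        ubarPart_uMonomial, uPart_uMonomial, zero_add, zero_add, momentTerm,
        ← monomial_zero_eq_C_apply, monomial_mul_monomial, zero_add, mul_assoc,
        add_comm p.1, add_assoc, add_comm m]
    · rintro ⟨x, y⟩ hx
      have : coeff x (rename uVar (nonlin F l)) = 0 := by
        by_contra h0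
        obtain ⟨k, rfl, -⟩ := coeff_rename_nonlin_ne_zero F h0
        exact hx ⟨(k, y), rfl⟩
      simp only [T, this, zero_mul, map_zero]
  rw [← Finset.HasAntidiagonal.sigmaAntidiagonalEquivProd.hasSum_iff] at hT
  refine HasSum.sigma hT fun d => ?_
  rw [coeff_mul, Finset.sum_mul, map_sum]
  refine (Finset.hasSum (antidiagonal d) fun q => monomial (yPart d)
    (coeff q.1 (rename uVar (nonlin F l)) * coeff q.2 (expInteraction F) *
      gaussMonomial (linMatrix F) (ubarPart d) (uPart d + m : Fin n →₀ ℕ))).congr_fun fun q => ?_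
  simp only [Function.comp, T, HasAntidiagonal.sigmaAntidiagonalEquivProd_apply,
    HasAntidiagonal.mem_antidiagonal.1 q.2]

theorem moment_add_single (m : Fin n →₀ ℕ) (i : Fin n) :
    moment F (m + Finsupp.single i 1) = ∑ l, C ((linMatrix F)⁻¹ i l) *
      (X l * moment F m + ∑' k, C (coeff k (nonlin F l)) * moment F (m + k)) := by
  refine (hasSum_moment F _).unique ?_
  have h : ∀ l, HasSum (fun d => monomial (yPart d)
      (coeff d (pderiv R (ubarVar l) (expInteraction F)) *
        gaussMonomial (linMatrix F) (ubarPart d) (uPart d + m : Fin n →₀ ℕ)))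
      (X l * moment F m + ∑' k, C (coeff k (nonlin F l)) * moment F (m + k)) := by
    intro l
    refine ((hasSum_X_mul_moment F m l).add
      (hasSum_nonlin_mul_expInteraction F m l)).congr_fun fun d => ?_
    rw [pderiv_expInteraction, add_mul, map_add, add_mul, map_add, add_comm]
  -- The shift by `ū_l` turns the factor `d(ū_l) + 1` of the derivative into `d(ū_l)`, the
  -- multiplicity in `gaussMonomial_add_single`; exponents not reached by the shift have `d(ū_l) =
  -- 0`.
  have h' : ∀ l, HasSum (fun d => monomial (yPart d) (coeff d (expInteraction F) *
      (d (ubarVar l) * gaussMonomial (linMatrix F)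
        (ubarPart d - Finsupp.single l 1 : Fin n →₀ ℕ) (uPart d + m : Fin n →₀ ℕ))))
      (X l * moment F m + ∑' k, C (coeff k (nonlin F l)) * moment F (m + k)) := by
    intro l
    rw [← Function.Injective.hasSum_iff (add_left_injective (Finsupp.single (ubarVar l) 1))]
    · refine (h l).congr_fun fun d => ?_
      simp only [Function.comp, coeff_pderiv, yPart_add, ubarPart_add, uPart_add]
      simp [mul_assoc]
    · intro d hd
      have : d (ubarVar l) = 0 := by
        by_contra h0
        exact hd ⟨d - _, tsub_add_cancel_of_le (by simpa [Nat.one_le_iff_ne_zero] using h0)⟩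
      simp [this]
  refine (hasSum_sum fun l _ => (h' l).mul_left (C ((linMatrix F)⁻¹ i l))).congr_fun fun d => ?_
  rw [momentTerm, ← add_assoc, gaussMonomial_add_single, Finset.mul_sum, map_sum]
  refine Finset.sum_congr rfl fun l _ => ?_
  rw [← monomial_zero_eq_C_apply, monomial_mul_monomial, zero_add]
  congr 1
  simp only [ubarPart_apply]
  ring

end Moments

/-! ### The Schwinger–Dyson equations and their unique solution -/

section SchwingerDyson

theorem coeff_prod_pow_mul_eq_zero {n : ℕ} {R : Type*} [CommRing R]
    {G : Fin n → MvPowerSeries (Fin n) R}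
    (hG : ∀ i, constantCoeff (G i) = 0) (Z : MvPowerSeries (Fin n) R) {m a : Fin n →₀ ℕ}
    (h : a.degree < m.degree) : coeff a ((∏ j, G j ^ m j) * Z) = 0 := by
  refine coeff_of_lt_order ?_
  have h1 : (m.degree : ℕ∞) ≤ (∏ j, G j ^ m j).order := by
    refine le_trans ?_ (le_order_prod _ _)
    rw [Finsupp.degree_eq_sum, Nat.cast_sum]
    exact Finset.sum_le_sum fun j _ => le_order_pow_of_constantCoeff_eq_zero _ (hG j)
  calc (a.degree : ℕ∞) < m.degree := by exact_mod_cast h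
    _ ≤ (∏ j, G j ^ m j).order + Z.order := h1.trans le_self_add
    _ ≤ _ := le_order_mul

variable {n : ℕ} {R : Type*} [CommRing R] [UniformSpace R]
  (F : Fin n → MvPowerSeries (Fin n) R)

/-- Families of power series, indexed by multiindices, that vanish to the order given by the index
and solve the Schwinger–Dyson equations. -/
structure SchwingerDyson (Ψ : (Fin n →₀ ℕ) → MvPowerSeries (Fin n) R) : Prop where
  coeff_eq_zero : ∀ m a : Fin n →₀ ℕ, a.degree < m.degree → coeff a (Ψ m) = 0
  add_single : ∀ m i, Ψ (m + Finsupp.single i 1) = ∑ l, C ((linMatrix F)⁻¹ i l) *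
    (X l * Ψ m + ∑' k, C (coeff k (nonlin F l)) * Ψ (m + k))

variable [DiscreteUniformity R]

theorem summable_of_coeff_eq_zero_of_degree_lt {Ψ : (Fin n →₀ ℕ) → MvPowerSeries (Fin n) R}
    (h : ∀ m a : Fin n →₀ ℕ, a.degree < m.degree → coeff a (Ψ m) = 0) (m : Fin n →₀ ℕ)
    (c : (Fin n →₀ ℕ) → R) : Summable fun k => C (c k) * Ψ (m + k) := by
  rw [← summableFamily_iff_summable]
  intro a
  refine (Finsupp.finite_of_degree_le (σ := Fin n) a.degree).subset fun k hk => ?_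
  by_contra hka
  refine hk ?_
  rw [coeff_C_mul, h, mul_zero]
  rw [map_add]
  exact lt_of_lt_of_le (not_le.1 hka) le_add_self

theorem coeff_tsum_C_mul {Ψ : (Fin n →₀ ℕ) → MvPowerSeries (Fin n) R}
    (h : ∀ m a : Fin n →₀ ℕ, a.degree < m.degree → coeff a (Ψ m) = 0) (m a : Fin n →₀ ℕ)
    (c : (Fin n →₀ ℕ) → R) :
    coeff a (∑' k, C (c k) * Ψ (m + k)) = ∑' k, c k * coeff a (Ψ (m + k)) := by
  have := WithPiTopology.hasSum_iff_hasSum_coeff.1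
    (summable_of_coeff_eq_zero_of_degree_lt h m c).hasSum a
  rw [← this.tsum_eq]
  simp only [coeff_C_mul]

variable {F}

/-- Double induction: upwards on the degree of `a`, and, for fixed degree, downwards on the degree
of `m`, starting where both coefficients vanish. In the equation for `m' + e_i`, the factor `Y_l`
lowers the degree of `a`, while `m' + k` with `|k| ≥ 2` has larger degree than `m' + e_i`. -/
theorem SchwingerDyson.eq_of_zero_eq {Ψ Ψ' : (Fin n →₀ ℕ) → MvPowerSeries (Fin n) R}
    (h : SchwingerDyson F Ψ) (h' : SchwingerDyson F Ψ') (h0 : Ψ 0 = Ψ' 0) (m : Fin n →₀ ℕ) :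
    Ψ m = Ψ' m := by
  classical
  suffices H : ∀ N (a : Fin n →₀ ℕ), a.degree = N → ∀ m, coeff a (Ψ m) = coeff a (Ψ' m) by
    ext a
    exact H _ a rfl m
  intro N
  induction N using Nat.strong_induction_on with
  | _ N ihN =>
  intro a ha
  -- Downward induction on `|m|`, encoded by a counter `j` with `N < |m| + j`: at `j = 0` the order
  -- condition makes both coefficients zero, and `j = N + 1` covers every `m`.
  suffices H : ∀ j (m : Fin n →₀ ℕ), N < m.degree + j → coeff a (Ψ m) = coeff a (Ψ' m) from
    fun m => H (N + 1) m (by omega)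
  intro j
  induction j with
  | zero =>
    intro m hm
    rw [h.coeff_eq_zero m a (by omega), h'.coeff_eq_zero m a (by omega)]
  | succ j ihj =>
    intro m hm
    by_cases hm0 : m = 0
    · rw [hm0, h0]
    · obtain ⟨i, hi⟩ := DFunLike.ne_iff.1 hm0
      obtain ⟨m, rfl⟩ : ∃ m', m = m' + Finsupp.single i 1 :=
        ⟨m - Finsupp.single i 1, (tsub_add_cancel_of_le (by
          simpa [Nat.one_le_iff_ne_zero] using hi)).symm⟩
      rw [h.add_single, h'.add_single, map_sum, map_sum]
      refine Finset.sum_congr rfl fun l _ => ?_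
      rw [coeff_C_mul, coeff_C_mul, map_add, map_add, coeff_tsum_C_mul h.coeff_eq_zero,
        coeff_tsum_C_mul h'.coeff_eq_zero]
      congr 2
      · rw [X, coeff_monomial_mul, coeff_monomial_mul]
        split_ifs with hl
        · rw [ihN (a - Finsupp.single l 1).degree ?_ _ rfl]
          have := congrArg Finsupp.degree (tsub_add_cancel_of_le hl)
          rw [map_add, Finsupp.degree_single] at this
          omega
        · rfl
      · refine tsum_congr fun k => ?_
        by_cases hk : coeff k (nonlin F l) = 0
        · rw [hk, zero_mul, zero_mul]
        · have := two_le_degree_of_coeff_nonlin F hk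
          rw [ihj]
          rw [map_add, Finsupp.degree_single] at hm
          rw [map_add]
          omega

theorem schwingerDyson_moment [Algebra ℚ R] : SchwingerDyson F (moment F) :=
  ⟨fun _ _ h => coeff_moment_eq_zero F h, moment_add_single F⟩

/-- Multiplying the fixed-point equation for `G_i` by `G^m Z` gives the Schwinger–Dyson equation,
since `G^m G^k = G^(m+k)`; the order condition holds because every `G_j` lacks a constant term. -/
theorem schwingerDyson_prod_pow {G : Fin n → MvPowerSeries (Fin n) R}
    (hG : ∀ i, constantCoeff (G i) = 0)
    (hrec : ∀ i, G i = ∑ l, C ((linMatrix F)⁻¹ i l) *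
      (X l + ∑' k, C (coeff k (nonlin F l)) * ∏ j, G j ^ k j)) (Z : MvPowerSeries (Fin n) R) :
    SchwingerDyson F fun m => (∏ j, G j ^ m j) * Z := by
  refine ⟨fun m a h => coeff_prod_pow_mul_eq_zero hG Z h, fun m i => ?_⟩
  have h1 : (∏ j, G j ^ (m + Finsupp.single i 1 : Fin n →₀ ℕ) j) = (∏ j, G j ^ m j) * G i := by
    simp only [Finsupp.add_apply, pow_add, Finset.prod_mul_distrib]
    congr 1
    rw [Finset.prod_eq_single i] <;> simp +contextual [eq_comm]
  have h2 : ∀ l, (∑' k, C (coeff k (nonlin F l)) *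
      ((∏ j, G j ^ (m + k : Fin n →₀ ℕ) j) * Z)) =
      (∑' k, C (coeff k (nonlin F l)) * ∏ j, G j ^ k j) * ((∏ j, G j ^ m j) * Z) := by
    intro l
    have hs : Summable fun k : Fin n →₀ ℕ => C (coeff k (nonlin F l)) * ∏ j, G j ^ k j := by
      have := summable_of_coeff_eq_zero_of_degree_lt
        (fun m a h => coeff_prod_pow_mul_eq_zero hG 1 h) 0 fun k => coeff k (nonlin F l)
      simpa using this
    rw [← hs.tsum_mul_right]
    refine tsum_congr fun k => ?_
    simp only [Finsupp.add_apply, pow_add, Finset.prod_mul_distrib]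
    ring
  simp only [h1, h2]
  conv_lhs => rw [hrec i]
  rw [mul_assoc, mul_comm, mul_assoc, Finset.sum_mul]
  refine Finset.sum_congr rfl fun l _ => ?_
  ring

theorem moment_single_eq [Algebra ℚ R] {G : Fin n → MvPowerSeries (Fin n) R}
    (hG : ∀ i, constantCoeff (G i) = 0)
    (hrec : ∀ i, G i = ∑ l, C ((linMatrix F)⁻¹ i l) *
      (X l + ∑' k, C (coeff k (nonlin F l)) * ∏ j, G j ^ k j)) (i : Fin n) :
    moment F (Finsupp.single i 1) = G i * moment F 0 := by
  rw [schwingerDyson_moment.eq_of_zero_eq (schwingerDyson_prod_pow hG hrec (moment F 0)) (by simp)]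
  congr 1
  rw [Finset.prod_eq_single i] <;> simp +contextual [eq_comm]

end SchwingerDyson

/-! ### Planar trees -/

/-- Planar rooted trees without vertices having exactly one child. -/
inductive PTree : Type
  | mk (d : {d : ℕ // d ≠ 1}) (ch : Fin d → PTree) : PTree

namespace PTree

/-- A tree is given by the family of its branches. -/
def equivSigma : (Σ d : {d : ℕ // d ≠ 1}, Fin d → PTree) ≃ PTree where
  toFun p := mk p.1 p.2
  invFun t := match t with | mk d ch => ⟨d, ch⟩
  left_inv _ := rfl
  right_inv t := by cases t; rfl

/-- The product of the inverses of the numbers of orderings of the children of the vertices. -/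
def weight : PTree → ℚ
  | mk d ch => (d.1.factorial : ℚ)⁻¹ * ∏ k, (ch k).weight

/-- The number of leaves. -/
def leaves : PTree → ℕ
  | mk d ch => if d.1 = 0 then 1 else ∑ k, (ch k).leaves

theorem leaves_pos (t : PTree) : 0 < t.leaves := by
  induction t with
  | mk d ch ih =>
    rw [leaves]
    split_ifs with h
    · exact one_pos
    · exact Finset.sum_pos (fun k _ => ih k) ⟨⟨0, Nat.pos_of_ne_zero h⟩, Finset.mem_univ _⟩

theorem arity_le_leaves (d : {d : ℕ // d ≠ 1}) (ch : Fin d → PTree) : d.1 ≤ (mk d ch).leaves := by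
  rw [leaves]
  split_ifs with h
  · omega
  · calc d.1 = ∑ k : Fin d, 1 := by simp
      _ ≤ _ := Finset.sum_le_sum fun k _ => (ch k).leaves_pos

/-- A vertex with one child has at least two, so each branch leaves a leaf to some other branch. -/
theorem leaves_branch_lt (d : {d : ℕ // d ≠ 1}) (ch : Fin d → PTree) (k : Fin d) :
    (ch k).leaves < (mk d ch).leaves := by
  have hd : d.1 ≠ 0 := (Fin.pos k).ne'
  have hd2 := d.2
  rw [leaves, if_neg hd, ← Finset.add_sum_erase _ _ (Finset.mem_univ k)]
  have : 0 < ∑ x ∈ Finset.univ.erase k, (ch x).leaves := by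
    refine Finset.sum_pos (fun x _ => leaves_pos _) ?_
    rw [← Finset.card_pos, Finset.card_erase_of_mem (Finset.mem_univ k), Finset.card_fin]
    omega
  omega

/-- Excluding arity 1 is essential: chains would give infinitely many trees with one leaf. Here the
root arity is at most the number of leaves and the branches have strictly fewer leaves. -/
theorem finite_leaves_le (N : ℕ) : {t : PTree | t.leaves ≤ N}.Finite := by
  induction N with
  | zero => exact Set.finite_empty.subset fun t ht => absurd t.leaves_pos (by simpa using ht)
  | succ N ih =>
    have h : (⋃ d ∈ {d : {d : ℕ // d ≠ 1} | d.1 ≤ N + 1},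
        (fun ch : Fin d → PTree => mk d ch) '' Set.pi Set.univ fun _ => {t | t.leaves ≤ N}).Finite := by
      refine Set.Finite.biUnion ?_ fun d _ => (Set.Finite.pi fun _ => ih).image _
      exact (Set.finite_le_nat (N + 1)).preimage Subtype.val_injective.injOn
    refine h.subset ?_
    rintro ⟨d, ch⟩ ht
    simp only [Set.mem_iUnion]
    refine ⟨d, (arity_le_leaves d ch).trans ht, ch, fun k _ => ?_, rfl⟩
    exact Nat.le_of_lt_succ ((leaves_branch_lt d ch k).trans_le ht)

end PTree

/-! ### The generating series of planar trees and its fixed-point equation. -/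

section Series

variable {n : ℕ} {R : Type*} [CommRing R] (F : Fin n → MvPowerSeries (Fin n) R)

/-- The factor of a vertex with index `l` whose children have multiplicity multiindex `q`. -/
def vertexFactor (l : Fin n) (q : Fin n →₀ ℕ) : MvPowerSeries (Fin n) R :=
  if q = 0 then X l else C (tensorCoeff (nonlin F l) q)

/-- The amplitude of a planar tree. -/
def PTree.amp : PTree → Fin n → MvPowerSeries (Fin n) R
  | mk d ch, i => ∑ l, C ((linMatrix F)⁻¹ i l) *
      ∑ ks : Fin d → Fin n, vertexFactor F l (mult ks) * ∏ k, (ch k).amp (ks k)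

theorem natCast_le_order_sum {σ ι : Type*} (s : Finset ι) (f : ι → MvPowerSeries σ R) (N : ℕ)
    (h : ∀ i ∈ s, (N : ℕ∞) ≤ (f i).order) : (N : ℕ∞) ≤ (∑ i ∈ s, f i).order := by
  refine nat_le_order fun d hd => ?_
  rw [map_sum]
  refine Finset.sum_eq_zero fun i hi => coeff_of_lt_order ?_
  exact lt_of_lt_of_le (by exact_mod_cast hd) (h i hi)

theorem mult_eq_zero_iff {d : ℕ} (ks : Fin d → Fin n) : mult ks = 0 ↔ d = 0 := by
  have : (mult ks).degree = d := by simp [mult, map_sum]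
  rw [← Finsupp.degree_eq_zero_iff, this]

/-- Each leaf contributes a factor `X l`, and orders add under multiplication. Hence only finitely
many trees affect a given coefficient. -/
theorem PTree.leaves_le_order_amp (t : PTree) (i : Fin n) :
    (t.leaves : ℕ∞) ≤ (t.amp F i).order := by
  induction t generalizing i with
  | mk d ch ih =>
    rw [amp]
    refine natCast_le_order_sum _ _ _ fun l _ => le_trans ?_ le_order_mul
    refine le_add_left (natCast_le_order_sum _ _ _ fun ks _ => le_trans ?_ le_order_mul)
    rw [leaves]
    split_ifs with h
    · refine le_add_right ?_
      rw [vertexFactor, if_pos ((mult_eq_zero_iff ks).2 h), Nat.cast_one,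
        one_le_order_iff_constCoeff_eq_zero, constantCoeff_X]
    · refine le_add_left (le_trans ?_ (le_order_prod _ _))
      rw [Nat.cast_sum]
      exact Finset.sum_le_sum fun k _ => ih k _

/-- The fibre is counted by a multinomial coefficient, read off by comparing the coefficients of
`X^q` in two expansions of `(∑ X_j)^d`. -/
theorem card_mult_fiber {d : ℕ} {q : Fin n →₀ ℕ} (hq : q.degree = d) :
    Fintype.card {ks : Fin d → Fin n // mult ks = q} * ∏ j, (q j).factorial = d.factorial := by
  classical
  have h1 : Fintype.card {ks : Fin d → Fin n // mult ks = q} = Nat.multinomial univ q := by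
    have h := (Fintype.sum_pow (fun j : Fin n => (MvPolynomial.X j : MvPolynomial (Fin n) ℕ)) d).symm.trans
      (Finset.sum_pow_eq_sum_piAntidiag univ _ d)
    have h := congrArg (MvPolynomial.coeff q) h
    have hl : ∀ ks : Fin d → Fin n, ∏ k, (MvPolynomial.X (ks k) : MvPolynomial (Fin n) ℕ) =
        MvPolynomial.monomial (mult ks) 1 := fun ks => by
      simp [mult, MvPolynomial.X, MvPolynomial.monomial_sum_one]
    have hr : ∀ k : Fin n → ℕ, ∏ j, (MvPolynomial.X j : MvPolynomial (Fin n) ℕ) ^ k j =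
        MvPolynomial.monomial (Finsupp.equivFunOnFinite.symm k) 1 := fun k => by
      rw [MvPolynomial.monomial_eq, Finsupp.prod_fintype] <;> simp
    have hk : ∀ k : Fin n → ℕ, Finsupp.equivFunOnFinite.symm k = q ↔ k = q := fun k => by
      rw [Equiv.symm_apply_eq]; rfl
    simp only [hl, hr, MvPolynomial.coeff_sum, MvPolynomial.coeff_monomial] at h
    rw [Fintype.card_subtype, Finset.card_filter, h, Finset.sum_eq_single ⇑q]
    · rw [← map_natCast (MvPolynomial.C (R := ℕ) (σ := Fin n)), MvPolynomial.coeff_C_mul,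
        MvPolynomial.coeff_monomial, if_pos ((hk q).2 rfl)]
      simp
    · intro k _ hkq
      rw [← map_natCast (MvPolynomial.C (R := ℕ) (σ := Fin n)), MvPolynomial.coeff_C_mul,
        MvPolynomial.coeff_monomial, if_neg (mt (hk k).1 hkq), mul_zero]
    · intro hq'
      exact absurd (by simpa [Finset.mem_piAntidiag, ← Finsupp.degree_eq_sum] using hq) hq'
  rw [h1, mul_comm, Nat.multinomial_spec, ← hq, Finsupp.degree_eq_sum]

variable [Algebra ℚ R]

variable [UniformSpace R] [DiscreteUniformity R]

theorem summable_weight_smul_amp (i : Fin n) : Summable fun t : PTree => t.weight • t.amp F i := by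
  rw [← summableFamily_iff_summable]
  intro a
  refine (PTree.finite_leaves_le a.degree).subset fun t ht => ?_
  by_contra h
  refine ht ?_
  change coeff a (t.weight • t.amp F i) = 0
  have h1 : (a.degree : ℕ∞) < (t.amp F i).order :=
    lt_of_lt_of_le (by exact_mod_cast not_le.1 h) (t.leaves_le_order_amp F i)
  rw [Algebra.smul_def, MvPowerSeries.algebraMap_apply, coeff_C_mul, coeff_of_lt_order h1, mul_zero]

/-- The sum of the weighted amplitudes of planar trees. -/
def treeSeries (i : Fin n) : MvPowerSeries (Fin n) R := ∑' t : PTree, t.weight • t.amp F i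

theorem hasSum_treeSeries (i : Fin n) :
    HasSum (fun t : PTree => t.weight • t.amp F i) (treeSeries F i) :=
  (summable_weight_smul_amp F i).hasSum

theorem constantCoeff_treeSeries (i : Fin n) : constantCoeff (treeSeries F i) = 0 := by
  have h := WithPiTopology.hasSum_iff_hasSum_coeff.1 (hasSum_treeSeries F i) 0
  rw [← coeff_zero_eq_constantCoeff_apply, ← h.tsum_eq]
  refine (tsum_congr fun t => ?_).trans tsum_zero
  have h1 : ((0 : Fin n →₀ ℕ).degree : ℕ∞) < (t.amp F i).order :=
    lt_of_lt_of_le (by simpa using t.leaves_pos) (t.leaves_le_order_amp F i)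
  rw [Algebra.smul_def, MvPowerSeries.algebraMap_apply, coeff_C_mul, coeff_of_lt_order h1, mul_zero]

/-- The weight and the amplitude factor over the branches, so summing over all families of `d`
branches gives products of `d` tree series. -/
theorem hasSum_branches (i : Fin n) (d : {d : ℕ // d ≠ 1}) :
    HasSum (fun ch : Fin d → PTree => (PTree.mk d ch).weight • (PTree.mk d ch).amp F i)
      (∑ l, C ((linMatrix F)⁻¹ i l) * ((d.1.factorial : ℚ)⁻¹ •
        ∑ ks : Fin d → Fin n, vertexFactor F l (mult ks) * ∏ k, treeSeries F (ks k))) := by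
  have h : ∀ ks : Fin d → Fin n, HasSum (fun ch : Fin d → PTree =>
      ∏ k, ((ch k).weight • (ch k).amp F (ks k))) (∏ k, treeSeries F (ks k)) :=
    fun ks => hasSum_pi_prod (f := fun k (t : PTree) => t.weight • t.amp F (ks k))
      (a := fun k => treeSeries F (ks k)) fun k => hasSum_treeSeries F (ks k)
  have h1 : ∀ l, HasSum (fun ch : Fin d → PTree => (d.1.factorial : ℚ)⁻¹ •
      ∑ ks : Fin d → Fin n, vertexFactor F l (mult ks) *
        ∏ k, ((ch k).weight • (ch k).amp F (ks k)))
      ((d.1.factorial : ℚ)⁻¹ •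
        ∑ ks : Fin d → Fin n, vertexFactor F l (mult ks) * ∏ k, treeSeries F (ks k)) := by
    intro l
    simp only [Algebra.smul_def (d.1.factorial : ℚ)⁻¹]
    refine HasSum.mul_left _ ?_
    exact hasSum_sum fun ks _ => (h ks).mul_left (vertexFactor F l (mult ks))
  have h2 : HasSum (fun ch : Fin d → PTree => ∑ l, C ((linMatrix F)⁻¹ i l) *
      ((d.1.factorial : ℚ)⁻¹ • ∑ ks : Fin d → Fin n, vertexFactor F l (mult ks) *
        ∏ k, ((ch k).weight • (ch k).amp F (ks k))))
      (∑ l, C ((linMatrix F)⁻¹ i l) * ((d.1.factorial : ℚ)⁻¹ •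
        ∑ ks : Fin d → Fin n, vertexFactor F l (mult ks) * ∏ k, treeSeries F (ks k))) :=
    hasSum_sum fun l _ => (h1 l).mul_left _
  refine h2.congr_fun fun ch => ?_
  rw [PTree.weight, PTree.amp, Finset.smul_sum]
  refine Finset.sum_congr rfl fun l _ => ?_
  rw [mul_smul, ← mul_smul_comm, ← mul_smul_comm, Finset.smul_sum]
  congr 2
  refine Finset.sum_congr rfl fun ks _ => ?_
  simp only [Algebra.smul_def, map_prod, Finset.prod_mul_distrib]
  ring

/-- From tensor elements to power series coefficients: `d!/q!` index maps have multiplicity `q`,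
which cancels the prefactor `1/d!` and the `q!` in `tensorCoeff`. The case `q = 0` is the leaf. -/
theorem hasSum_vertexFactor {d : ℕ} (l : Fin n) (G : Fin n → MvPowerSeries (Fin n) R) :
    HasSum (fun q : {q : Fin n →₀ ℕ // q.degree = d} =>
        (if q.1 = 0 then X l else C (coeff q.1 (nonlin F l))) * ∏ j, G j ^ q.1 j)
      ((d.factorial : ℚ)⁻¹ •
        ∑ ks : Fin d → Fin n, vertexFactor F l (mult ks) * ∏ k, G (ks k)) := by
  classical
  rw [Finset.smul_sum]
  have h := hasSum_fintype fun ks : Fin d → Fin n =>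
    (d.factorial : ℚ)⁻¹ • (vertexFactor F l (mult ks) * ∏ k, G (ks k))
  let p : (Fin d → Fin n) → {q : Fin n →₀ ℕ // q.degree = d} := fun ks =>
    ⟨mult ks, by simp [mult, map_sum]⟩
  rw [← (Equiv.sigmaFiberEquiv p).hasSum_iff] at h
  refine HasSum.sigma h fun q => ?_
  have hc : ∀ ks : {ks // p ks = q}, (d.factorial : ℚ)⁻¹ •
      (vertexFactor F l (mult ks.1) * ∏ k, G (ks.1 k)) =
      (d.factorial : ℚ)⁻¹ • (vertexFactor F l q.1 * ∏ j, G j ^ q.1 j) := by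
    rintro ⟨ks, rfl⟩
    congr 2
    rw [← Finset.prod_fiberwise (s := univ) (g := ks) (f := fun k => G (ks k))]
    refine Finset.prod_congr rfl fun j _ => ?_
    rw [Finset.prod_congr rfl (g := fun _ => G j) (by simp +contextual), Finset.prod_const]
    congr 1
    rw [mult_apply, Fintype.card_subtype]
  have h2 := hasSum_fintype fun _ : {ks // p ks = q} =>
    (d.factorial : ℚ)⁻¹ • (vertexFactor F l q.1 * ∏ j, G j ^ q.1 j)
  have hcard : Fintype.card {ks // p ks = q} * ∏ j, (q.1 j).factorial = d.factorial := by
    rw [← card_mult_fiber q.2]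
    congr 1
    exact Fintype.card_congr (Equiv.subtypeEquivRight fun ks => Subtype.ext_iff)
  rw [Finset.sum_const, Finset.card_univ] at h2
  convert h2 using 1
  · ext1 ks
    exact hc ks
  · rw [← Nat.cast_smul_eq_nsmul ℚ, smul_smul]
    have h0 : (∏ j, ((q.1 j).factorial : ℚ)) ≠ 0 := by positivity
    have h3 : (Fintype.card {ks // p ks = q} : ℚ) * (d.factorial : ℚ)⁻¹ =
        (∏ j, ((q.1 j).factorial : ℚ))⁻¹ := by
      rw [← hcard]
      have : (Fintype.card {ks // p ks = q} : ℚ) ≠ 0 := by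
        intro hz
        rw [Nat.cast_eq_zero] at hz
        rw [hz, zero_mul] at hcard
        exact (Nat.factorial_pos d).ne hcard
      push_cast
      field_simp
    rw [h3, ← smul_mul_assoc]
    congr 1
    rw [vertexFactor]
    split_ifs with hq
    · simp [hq]
    · rw [Algebra.smul_def, MvPowerSeries.algebraMap_apply, ← map_mul, tensorCoeff, ← mul_assoc]
      have : algebraMap ℚ R (∏ j, ((q.1 j).factorial : ℚ))⁻¹ * ∏ j, ((q.1 j).factorial : R) = 1 := by
        have : ∏ j, ((q.1 j).factorial : R) = algebraMap ℚ R (∏ j, ((q.1 j).factorial : ℚ)) := by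
          simp
        rw [this, ← map_mul, inv_mul_cancel₀ h0, map_one]
      rw [this, one_mul]

theorem hasSum_arity (l : Fin n) :
    HasSum (fun d : {d : ℕ // d ≠ 1} => (d.1.factorial : ℚ)⁻¹ •
        ∑ ks : Fin d → Fin n, vertexFactor F l (mult ks) * ∏ k, treeSeries F (ks k))
      (X l + ∑' k, C (coeff k (nonlin F l)) * ∏ j, treeSeries F j ^ k j) := by
  classical
  have hs : Summable fun k : Fin n →₀ ℕ =>
      C (coeff k (nonlin F l)) * ∏ j, treeSeries F j ^ k j := by
    have := summable_of_coeff_eq_zero_of_degree_lt (fun m a h =>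
      coeff_prod_pow_mul_eq_zero (constantCoeff_treeSeries F) 1 h) 0 fun k => coeff k (nonlin F l)
    simpa using this
  -- The constant coefficient of `nonlin F l` is zero, so the vacant index `k = 0` can carry the
  -- leaf term `X l`.
  have h := (hasSum_ite_eq (0 : Fin n →₀ ℕ) (X l : MvPowerSeries (Fin n) R)).add hs.hasSum
  have h0 : ∀ k : Fin n →₀ ℕ, (if k = 0 then X l else C (coeff k (nonlin F l))) *
      ∏ j, treeSeries F j ^ k j = (if k = 0 then X l else 0) +
        C (coeff k (nonlin F l)) * ∏ j, treeSeries F j ^ k j := by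
    intro k
    split_ifs with hk
    · simp [hk, coeff_nonlin]
    · rw [zero_add]
  simp only [← h0] at h
  rw [← (Equiv.sigmaFiberEquiv fun k : Fin n →₀ ℕ => k.degree).hasSum_iff] at h
  have h1 := HasSum.sigma h fun d => hasSum_vertexFactor F l (treeSeries F)
  -- The sum over all arities restricts to `d ≠ 1` because `nonlin F l` has no linear part.
  rw [← (Subtype.val_injective (p := fun d : ℕ => d ≠ 1)).hasSum_iff] at h1
  · exact h1
  · intro d hd
    have hd : d = 1 := by simpa using hd
    subst hd
    rw [Finset.sum_eq_zero, smul_zero]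
    intro ks _
    have : (mult ks).degree = 1 := by simp [mult]
    rw [vertexFactor, if_neg (fun h => by simp [h] at this), tensorCoeff, coeff_nonlin, this]
    simp

/-- A planar tree is a root arity together with its branches, so the sum over trees is an iterated
sum over arities and branches. -/
theorem treeSeries_eq (i : Fin n) : treeSeries F i = ∑ l, C ((linMatrix F)⁻¹ i l) *
    (X l + ∑' k, C (coeff k (nonlin F l)) * ∏ j, treeSeries F j ^ k j) := by
  have h := hasSum_treeSeries F i
  rw [← PTree.equivSigma.hasSum_iff] at h
  refine (HasSum.sigma h fun d => hasSum_branches F i d).unique ?_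
  exact hasSum_sum fun l _ => (hasSum_arity F l).mul_left _

end Series

/-! ### Parent maps of diagrams with a single `u`-source -/

section Presentation

variable {E : Type*} [DecidableEq E] {V : Type*} [Fintype V] [DecidableEq V]

/-- The vertex attached to `x`: its `ū`-half-line and the `u`-half-lines of its children. -/
def block (par : V → Option V) (ub uu : V → E) (x : V) : Finset E :=
  insert (ub x) (({y | par y = some x} : Finset V).image uu)

theorem mem_block {par : V → Option V} {ub uu : V → E} {x : V} {e : E} :
    e ∈ block par ub uu x ↔ e = ub x ∨ ∃ y, par y = some x ∧ uu y = e := by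
  simp [block]

variable [Fintype E]

/-- The diagram `D` is encoded by the parent map `par` on the set `V` of its vertices that are not
the `u`-source: `ub x` is the `ū`-half-line of the vertex `x`, and `uu x` the `u`-half-line with
which it is contracted. -/
structure IsPres (D : Feynman (Fin 1) Empty E) (par : V → Option V) (ub uu : V → E) : Prop where
  ub_inj : Function.Injective ub
  uu_inj : Function.Injective uu
  mem_Eubar : ∀ e, e ∈ D.Eubar ↔ ∃ x, ub x = e
  mem_Eu : ∀ e, e ∈ D.Eu ↔ ∃ x, uu x = e
  contr : ∀ (x : V) (h : ub x ∈ D.Eubar), (D.contr ⟨ub x, h⟩ : E) = uu x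
  root : ∀ x, uu x = D.rhoU 0 ↔ par x = none
  mem_piH : ∀ B, B ∈ D.piH ↔ ∃ x, (∃ y, par y = some x) ∧ B = block par ub uu x
  mem_piY : ∀ B, B ∈ D.piY ↔ ∃ x, (∀ y, par y ≠ some x) ∧ B = block par ub uu x

namespace Feynman

theorem notMem_Eu_of_mem_Eubar {I J : Type*} (D : Feynman I J E) {e : E} (h : e ∈ D.Eubar) :
    e ∉ D.Eu := fun h' =>
  Finset.disjoint_left.1 D.isCompl_u_ubar.disjoint h' h

theorem mem_Eu_or_mem_Eubar {I J : Type*} (D : Feynman I J E) (e : E) :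
    e ∈ D.Eu ∨ e ∈ D.Eubar := by
  rw [← Finset.mem_union, ← Finset.sup_eq_union, D.isCompl_u_ubar.sup_eq_top]
  exact Finset.mem_univ e

theorem notMem_Eext_of_mem_Eint {I J : Type*} (D : Feynman I J E) {e : E} (h : e ∈ D.Eint) :
    e ∉ D.Eext := fun h' =>
  Finset.disjoint_left.1 D.isCompl_int_ext.disjoint h h'

theorem mem_Eint_or_mem_Eext {I J : Type*} (D : Feynman I J E) (e : E) :
    e ∈ D.Eint ∨ e ∈ D.Eext := by
  rw [← Finset.mem_union, ← Finset.sup_eq_union, D.isCompl_int_ext.sup_eq_top]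
  exact Finset.mem_univ e

theorem mem_Eext_iff (D : Feynman (Fin 1) Empty E) {e : E} : e ∈ D.Eext ↔ e = D.rhoU 0 := by
  constructor
  · intro h
    rcases D.mem_Eu_or_mem_Eubar e with h' | h'
    · obtain ⟨i, -, hi⟩ := D.bijOn_rhoU.surjOn (Finset.mem_coe.2 (Finset.mem_inter.2 ⟨h, h'⟩))
      rw [← hi, Subsingleton.elim i 0]
    · obtain ⟨i, -, -⟩ := D.bijOn_rhoUbar.surjOn (Finset.mem_coe.2 (Finset.mem_inter.2 ⟨h, h'⟩))
      exact i.elim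
  · rintro rfl
    exact (Finset.mem_inter.1 (D.bijOn_rhoU.mapsTo (Set.mem_univ 0))).1

theorem rhoU_mem_Eu (D : Feynman (Fin 1) Empty E) : D.rhoU 0 ∈ D.Eu :=
  (Finset.mem_inter.1 (D.bijOn_rhoU.mapsTo (Set.mem_univ 0))).2

theorem exists_block {I J : Type*} (D : Feynman I J E) {e : E} (h : e ∈ D.Eint) :
    ∃ B ∈ D.piH ∪ D.piY, e ∈ B := by
  obtain ⟨P, hP⟩ := D.partition_int
  obtain ⟨B, hB, he⟩ := P.exists_mem h
  exact ⟨B, hP ▸ hB, he⟩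

theorem block_subset {I J : Type*} (D : Feynman I J E) {B : Finset E} (h : B ∈ D.piH ∪ D.piY) :
    B ⊆ D.Eint := by
  obtain ⟨P, hP⟩ := D.partition_int
  exact P.le (hP ▸ h)

theorem block_unique {I J : Type*} (D : Feynman I J E) {B B' : Finset E}
    (h : B ∈ D.piH ∪ D.piY) (h' : B' ∈ D.piH ∪ D.piY) {e : E} (he : e ∈ B) (he' : e ∈ B') :
    B = B' := by
  obtain ⟨P, hP⟩ := D.partition_int
  exact P.eq_of_mem_parts (hP ▸ h) (hP ▸ h') he he'

theorem eq_of_mem_block {I J : Type*} (D : Feynman I J E) {B : Finset E}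
    (h : B ∈ D.piH ∪ D.piY) {e e' : E} (he : e ∈ B) (he' : e' ∈ B) (hu : e ∈ D.Eubar)
    (hu' : e' ∈ D.Eubar) : e = e' := by
  have hc : (B ∩ D.Eubar).card = 1 := by
    rcases Finset.mem_union.1 h with h | h
    · exact (D.H_vertex B h).1
    · exact (D.Y_vertex B h).1
  exact Finset.card_le_one.1 hc.le e (Finset.mem_inter.2 ⟨he, hu⟩) e' (Finset.mem_inter.2 ⟨he', hu'⟩)

open Classical in
/-- The vertex into which the line leaving `y` goes, if it is not the `u`-source. -/
def parent (D : Feynman (Fin 1) Empty E) (y : {x // x ∈ D.Eubar}) : Option {x // x ∈ D.Eubar} :=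
  if h : ∃ x : {x // x ∈ D.Eubar}, ∃ B ∈ D.piH, x.1 ∈ B ∧ (D.contr y : E) ∈ B then some h.choose
  else none

/-- The choice in `parent` is forced: the blocks are disjoint, and each holds a single
`ū`-half-line. -/
theorem parent_eq_some_iff (D : Feynman (Fin 1) Empty E) {x y : {x // x ∈ D.Eubar}} :
    D.parent y = some x ↔ ∃ B ∈ D.piH, x.1 ∈ B ∧ (D.contr y : E) ∈ B := by
  unfold parent
  split_ifs with h
  · rw [Option.some_inj]
    constructor
    · rintro rfl
      exact h.choose_spec
    · rintro ⟨B, hB, hx, hy⟩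
      obtain ⟨B', hB', hx', hy'⟩ := h.choose_spec
      have := D.block_unique (Finset.mem_union_left _ hB) (Finset.mem_union_left _ hB') hy hy'
      subst this
      exact Subtype.ext (D.eq_of_mem_block (Finset.mem_union_left _ hB) hx' hx h.choose.2 x.2)
  · simp only [false_iff]
    exact fun h' => h ⟨x, h'⟩

theorem eq_block_of_mem_piH (D : Feynman (Fin 1) Empty E) {B : Finset E} (hB : B ∈ D.piH)
    {x : {x // x ∈ D.Eubar}} (hx : x.1 ∈ B) :
    B = block D.parent Subtype.val (fun y => (D.contr y : E)) x := by
  ext e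
  rw [mem_block]
  constructor
  · intro he
    rcases D.mem_Eu_or_mem_Eubar e with h | h
    · right
      refine ⟨D.contr.symm ⟨e, h⟩, ?_, by simp⟩
      rw [parent_eq_some_iff]
      exact ⟨B, hB, hx, by simpa using he⟩
    · exact Or.inl (D.eq_of_mem_block (Finset.mem_union_left _ hB) he hx h x.2)
  · rintro (rfl | ⟨y, hy, rfl⟩)
    · exact hx
    · rw [parent_eq_some_iff] at hy
      obtain ⟨B', hB', hx', hy'⟩ := hy
      rwa [D.block_unique (Finset.mem_union_left _ hB) (Finset.mem_union_left _ hB') hx hx']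

theorem exists_ubar_mem {I J : Type*} (D : Feynman I J E) {B : Finset E}
    (h : B ∈ D.piH ∪ D.piY) : ∃ x : {x // x ∈ D.Eubar}, x.1 ∈ B := by
  have hc : (B ∩ D.Eubar).card = 1 := by
    rcases Finset.mem_union.1 h with h | h
    · exact (D.H_vertex B h).1
    · exact (D.Y_vertex B h).1
  obtain ⟨x, hx⟩ := Finset.card_pos.1 (hc ▸ one_pos)
  exact ⟨⟨x, (Finset.mem_inter.1 hx).2⟩, (Finset.mem_inter.1 hx).1⟩

theorem exists_child_of_mem_piH (D : Feynman (Fin 1) Empty E) {B : Finset E} (hB : B ∈ D.piH)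
    {x : {x // x ∈ D.Eubar}} (hx : x.1 ∈ B) : ∃ y, D.parent y = some x := by
  obtain ⟨e, he⟩ := Finset.card_pos.1 (lt_of_lt_of_le two_pos (D.H_vertex B hB).2)
  rw [Finset.mem_inter] at he
  refine ⟨D.contr.symm ⟨e, he.2⟩, ?_⟩
  rw [parent_eq_some_iff]
  exact ⟨B, hB, hx, by simpa using he.1⟩

theorem ubar_mem_Eint (D : Feynman (Fin 1) Empty E) {e : E} (h : e ∈ D.Eubar) : e ∈ D.Eint := by
  refine (D.mem_Eint_or_mem_Eext e).resolve_right fun h' => ?_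
  rw [mem_Eext_iff] at h'
  exact D.notMem_Eu_of_mem_Eubar h (h' ▸ D.rhoU_mem_Eu)

theorem parent_ne_of_mem_piY (D : Feynman (Fin 1) Empty E) {B : Finset E} (hB : B ∈ D.piY)
    {x : {x // x ∈ D.Eubar}} (hx : x.1 ∈ B) (y : {x // x ∈ D.Eubar}) : D.parent y ≠ some x := by
  rw [ne_eq, parent_eq_some_iff]
  rintro ⟨B', hB', hx', -⟩
  rw [← D.block_unique (Finset.mem_union_right _ hB) (Finset.mem_union_left _ hB') hx hx'] at hB'
  exact Finset.disjoint_left.1 D.disjoint_H_Y hB' hB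

theorem eq_block_of_mem_piY (D : Feynman (Fin 1) Empty E) {B : Finset E} (hB : B ∈ D.piY)
    {x : {x // x ∈ D.Eubar}} (hx : x.1 ∈ B) :
    B = block D.parent Subtype.val (fun y => (D.contr y : E)) x := by
  ext e
  rw [mem_block]
  constructor
  · intro he
    rcases D.mem_Eu_or_mem_Eubar e with h | h
    · have := (D.Y_vertex B hB).2 ▸ Finset.mem_inter.2 ⟨he, h⟩
      simp at this
    · exact Or.inl (D.eq_of_mem_block (Finset.mem_union_right _ hB) he hx h x.2)
  · rintro (rfl | ⟨y, hy, rfl⟩)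
    · exact hx
    · exact absurd hy (D.parent_ne_of_mem_piY hB hx y)

/-- Every diagram with a single `u`-source and no `ū`-source is encoded by a parent map. -/
theorem isPres_parent (D : Feynman (Fin 1) Empty E) :
    IsPres D D.parent Subtype.val fun y => (D.contr y : E) where
  ub_inj := Subtype.val_injective
  uu_inj := Subtype.val_injective.comp D.contr.injective
  mem_Eubar e := by simp
  mem_Eu e := ⟨fun h => ⟨D.contr.symm ⟨e, h⟩, by simp⟩, by rintro ⟨x, rfl⟩; exact (D.contr x).2⟩
  contr _ _ := rfl
  root y := by
    constructor
    · intro h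
      by_contra hn
      obtain ⟨x, hx⟩ := Option.ne_none_iff_exists'.1 hn
      obtain ⟨B, hB, -, hy⟩ := D.parent_eq_some_iff.1 hx
      exact D.notMem_Eext_of_mem_Eint (D.block_subset (Finset.mem_union_left _ hB) hy)
        (D.mem_Eext_iff.2 h)
    · intro h
      rw [← mem_Eext_iff]
      refine (D.mem_Eint_or_mem_Eext _).resolve_left fun h' => ?_
      obtain ⟨B, hB, hy⟩ := D.exists_block h'
      obtain ⟨x, hx⟩ := D.exists_ubar_mem hB
      rcases Finset.mem_union.1 hB with hB | hB
      · rw [D.parent_eq_some_iff.2 ⟨B, hB, hx, hy⟩] at h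
        cases h
      · have := (D.Y_vertex B hB).2 ▸ Finset.mem_inter.2 ⟨hy, (D.contr y).2⟩
        simp at this
  mem_piH B := by
    constructor
    · intro hB
      obtain ⟨x, hx⟩ := D.exists_ubar_mem (Finset.mem_union_left _ hB)
      exact ⟨x, D.exists_child_of_mem_piH hB hx, D.eq_block_of_mem_piH hB hx⟩
    · rintro ⟨x, ⟨y, hy⟩, rfl⟩
      obtain ⟨B, hB, hx, -⟩ := D.parent_eq_some_iff.1 hy
      rwa [← D.eq_block_of_mem_piH hB hx]
  mem_piY B := by
    constructor
    · intro hB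
      obtain ⟨x, hx⟩ := D.exists_ubar_mem (Finset.mem_union_right _ hB)
      exact ⟨x, D.parent_ne_of_mem_piY hB hx, D.eq_block_of_mem_piY hB hx⟩
    · rintro ⟨x, hx, rfl⟩
      obtain ⟨B, hB, hxB⟩ := D.exists_block (D.ubar_mem_Eint x.2)
      rcases Finset.mem_union.1 hB with hB | hB
      · obtain ⟨y, hy⟩ := D.exists_child_of_mem_piH hB hxB
        exact absurd hy (hx y)
      · rwa [← D.eq_block_of_mem_piY hB hxB]

end Feynman

namespace IsPres

variable {D : Feynman (Fin 1) Empty E} {par : V → Option V} {ub uu : V → E}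

theorem ub_mem (h : IsPres D par ub uu) (x : V) : ub x ∈ D.Eubar := (h.mem_Eubar _).2 ⟨x, rfl⟩

theorem uu_mem (h : IsPres D par ub uu) (x : V) : uu x ∈ D.Eu := (h.mem_Eu _).2 ⟨x, rfl⟩

theorem ub_ne_uu (h : IsPres D par ub uu) (x y : V) : ub x ≠ uu y := fun hxy =>
  D.notMem_Eu_of_mem_Eubar (h.ub_mem x) (hxy ▸ h.uu_mem y)

theorem ub_mem_block (h : IsPres D par ub uu) {x y : V} :
    ub y ∈ block par ub uu x ↔ y = x := by
  rw [mem_block]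
  constructor
  · rintro (hy | ⟨z, -, hz⟩)
    · exact h.ub_inj hy
    · exact absurd hz.symm (h.ub_ne_uu _ _)
  · rintro rfl
    exact Or.inl rfl

theorem uu_mem_block (h : IsPres D par ub uu) {x y : V} :
    uu y ∈ block par ub uu x ↔ par y = some x := by
  rw [mem_block]
  constructor
  · rintro (hy | ⟨z, hz, hzy⟩)
    · exact absurd hy.symm (h.ub_ne_uu _ _)
    · rwa [← h.uu_inj hzy]
  · exact fun hy => Or.inr ⟨y, hy, rfl⟩

theorem block_inj (h : IsPres D par ub uu) : Function.Injective (block par ub uu) := by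
  intro x y hxy
  have : ub x ∈ block par ub uu x := h.ub_mem_block.2 rfl
  rw [hxy] at this
  exact h.ub_mem_block.1 this

theorem block_inter_Eubar (h : IsPres D par ub uu) (x : V) :
    block par ub uu x ∩ D.Eubar = {ub x} := by
  ext e
  rw [Finset.mem_inter, h.mem_Eubar, Finset.mem_singleton]
  constructor
  · rintro ⟨he, y, rfl⟩
    rw [h.ub_mem_block.1 he]
  · rintro rfl
    exact ⟨h.ub_mem_block.2 rfl, x, rfl⟩

theorem block_inter_Eu (h : IsPres D par ub uu) (x : V) :
    block par ub uu x ∩ D.Eu = ({y | par y = some x} : Finset V).image uu := by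
  ext e
  rw [Finset.mem_inter, h.mem_Eu, Finset.mem_image]
  constructor
  · rintro ⟨he, y, rfl⟩
    exact ⟨y, by simpa using h.uu_mem_block.1 he, rfl⟩
  · rintro ⟨y, hy, rfl⟩
    exact ⟨h.uu_mem_block.2 (by simpa using hy), y, rfl⟩

/-- A vertex with a child is an `H`-vertex, hence has at least two `u`-half-lines; this matches the
arity condition on planar trees. -/
theorem card_children_ne_one (h : IsPres D par ub uu) (x : V) :
    ({y | par y = some x} : Finset V).card ≠ 1 := by
  intro hc
  obtain ⟨y, hy⟩ := Finset.card_pos.1 (hc ▸ one_pos)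
  have hB := (h.mem_piH _).2 ⟨x, ⟨y, by simpa using hy⟩, rfl⟩
  have := (D.H_vertex _ hB).2
  rw [h.block_inter_Eu, Finset.card_image_of_injective _ h.uu_inj, hc] at this
  omega

theorem exists_root (h : IsPres D par ub uu) : ∃ r, par r = none := by
  obtain ⟨r, hr⟩ := (h.mem_Eu _).1 D.rhoU_mem_Eu
  exact ⟨r, (h.root r).1 hr⟩

theorem root_unique (h : IsPres D par ub uu) {x y : V} (hx : par x = none) (hy : par y = none) :
    x = y :=
  h.uu_inj (((h.root x).2 hx).trans ((h.root y).2 hy).symm)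

theorem bijective_elim (h : IsPres D par ub uu) : Function.Bijective (Sum.elim ub uu) := by
  constructor
  · rintro (x | x) (y | y) hxy
    · exact congrArg _ (h.ub_inj hxy)
    · exact absurd hxy (h.ub_ne_uu _ _)
    · exact absurd hxy.symm (h.ub_ne_uu _ _)
    · exact congrArg _ (h.uu_inj hxy)
  · intro e
    rcases D.mem_Eu_or_mem_Eubar e with he | he
    · obtain ⟨x, rfl⟩ := (h.mem_Eu e).1 he
      exact ⟨Sum.inr x, rfl⟩
    · obtain ⟨x, rfl⟩ := (h.mem_Eubar e).1 he
      exact ⟨Sum.inl x, rfl⟩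

/-- The half-lines, as two copies of the vertices. -/
def halfLineEquiv (h : IsPres D par ub uu) : V ⊕ V ≃ E := Equiv.ofBijective _ h.bijective_elim

@[simp] theorem halfLineEquiv_inl (h : IsPres D par ub uu) (x : V) :
    h.halfLineEquiv (Sum.inl x) = ub x := rfl

@[simp] theorem halfLineEquiv_inr (h : IsPres D par ub uu) (x : V) :
    h.halfLineEquiv (Sum.inr x) = uu x := rfl

@[simp] theorem halfLineEquiv_symm_ub (h : IsPres D par ub uu) (x : V) :
    h.halfLineEquiv.symm (ub x) = Sum.inl x := by
  rw [Equiv.symm_apply_eq]; rfl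

@[simp] theorem halfLineEquiv_symm_uu (h : IsPres D par ub uu) (x : V) :
    h.halfLineEquiv.symm (uu x) = Sum.inr x := by
  rw [Equiv.symm_apply_eq]; rfl

end IsPres

end Presentation

/-! ### Connected diagrams with a single `u`-source are trees -/

section Depth

variable {V : Type*}

/-- Every vertex reaches the root along the parent map, as witnessed by its depth. -/
def HasDepth (par : V → Option V) : Prop :=
  ∃ dep : Option V → ℕ, dep none = 0 ∧ ∀ x, dep (some x) = dep (par x) + 1

/-- The depth is the least number of iterations that reach `none`. -/
theorem hasDepth_of_iterate {par : V → Option V}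
    (h : ∀ o : Option V, ∃ k, (fun o => o.bind par)^[k] o = none) : HasDepth par := by
  classical
  refine ⟨fun o => Nat.find (h o), ?_, fun x => ?_⟩
  · rw [Nat.find_eq_zero]; rfl
  · rw [Nat.find_eq_iff]
    constructor
    · rw [Function.iterate_succ_apply]
      exact Nat.find_spec (h (par x))
    · rintro (_ | k) hk
      · simp
      · rw [Function.iterate_succ_apply]
        exact Nat.find_min (h (par x)) (Nat.lt_of_succ_lt_succ hk)

end Depth

namespace IsPres

section Graph

variable {E : Type*} [Fintype E] [DecidableEq E] {V : Type*} [Fintype V] [DecidableEq V]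
variable {D : Feynman (Fin 1) Empty E} {par : V → Option V} {ub uu : V → E}

theorem mem_uSources (a : Finset E) : a ∈ D.uSources ↔ a = {D.rhoU 0} := by
  simp only [Feynman.uSources, Finset.mem_image, Finset.mem_inter, D.mem_Eext_iff]
  constructor
  · rintro ⟨e, ⟨rfl, -⟩, rfl⟩
    rfl
  · rintro rfl
    exact ⟨_, ⟨rfl, D.rhoU_mem_Eu⟩, rfl⟩

theorem ubarSources_eq_empty : D.ubarSources = ∅ := by
  simp only [Feynman.ubarSources, Finset.image_eq_empty]
  rw [Finset.eq_empty_iff_forall_notMem]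
  intro e he
  rw [Finset.mem_inter, D.mem_Eext_iff] at he
  exact D.notMem_Eu_of_mem_Eubar he.2 (he.1 ▸ D.rhoU_mem_Eu)

theorem block_mem (h : IsPres D par ub uu) (x : V) :
    block par ub uu x ∈ D.piH ∨ block par ub uu x ∈ D.piY := by
  by_cases hx : ∃ y, par y = some x
  · exact Or.inl ((h.mem_piH _).2 ⟨x, hx, rfl⟩)
  · exact Or.inr ((h.mem_piY _).2 ⟨x, fun y hy => hx ⟨y, hy⟩, rfl⟩)

/-- The vertices of the digraph: the `u`-source, and the blocks. -/
def vert (h : IsPres D par ub uu) : Option V → D.Vertex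
  | none => ⟨{D.rhoU 0}, by simp [mem_uSources]⟩
  | some x => ⟨block par ub uu x, by
      simp only [Finset.mem_union]
      have := h.block_mem x
      tauto⟩

@[simp] theorem vert_none (h : IsPres D par ub uu) : (h.vert none).1 = {D.rhoU 0} := rfl

@[simp] theorem vert_some (h : IsPres D par ub uu) (x : V) :
    (h.vert (some x)).1 = block par ub uu x := rfl

theorem uu_mem_vert (h : IsPres D par ub uu) (y : V) (o : Option V) :
    uu y ∈ (h.vert o).1 ↔ par y = o := by
  cases o with
  | none => rw [vert_none, Finset.mem_singleton, h.root]
  | some x => rw [vert_some, h.uu_mem_block]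

theorem ub_mem_vert (h : IsPres D par ub uu) (y : V) (o : Option V) :
    ub y ∈ (h.vert o).1 ↔ o = some y := by
  cases o with
  | none =>
    rw [vert_none, Finset.mem_singleton]
    simp only [reduceCtorEq, iff_false]
    intro hy
    exact D.notMem_Eu_of_mem_Eubar (h.ub_mem y) (hy ▸ D.rhoU_mem_Eu)
  | some x => rw [vert_some, h.ub_mem_block, Option.some_inj, eq_comm]

theorem vert_bijective (h : IsPres D par ub uu) : Function.Bijective h.vert := by
  constructor
  · intro o o' ho
    have hmem : ∀ x, o = some x ↔ o' = some x := fun x => by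
      rw [← h.ub_mem_vert, ← h.ub_mem_vert, ho]
    exact Option.ext hmem
  · rintro ⟨a, ha⟩
    simp only [Finset.mem_union, mem_uSources, ubarSources_eq_empty, Finset.notMem_empty, or_false,
      h.mem_piH, h.mem_piY] at ha
    rcases ha with (rfl | ⟨x, -, rfl⟩) | ⟨x, -, rfl⟩
    · exact ⟨none, rfl⟩
    · exact ⟨some x, rfl⟩
    · exact ⟨some x, rfl⟩

theorem digraph_adj (h : IsPres D par ub uu) (o o' : Option V) :
    D.digraph.Adj (h.vert o) (h.vert o') ↔ ∃ x, o = some x ∧ par x = o' := by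
  constructor
  · rintro ⟨⟨e, he⟩, h1, h2⟩
    obtain ⟨x, rfl⟩ := (h.mem_Eubar e).1 he
    rw [h.contr, h.uu_mem_vert] at h2
    exact ⟨x, (h.ub_mem_vert x o).1 h1, h2⟩
  · rintro ⟨x, rfl, rfl⟩
    refine ⟨⟨ub x, h.ub_mem x⟩, (h.ub_mem_vert _ _).2 rfl, ?_⟩
    rw [h.contr, h.uu_mem_vert]

theorem graph_adj (h : IsPres D par ub uu) (o o' : Option V) :
    D.graph.Adj (h.vert o) (h.vert o') ↔ o ≠ o' ∧
      ((∃ x, o = some x ∧ par x = o') ∨ ∃ x, o' = some x ∧ par x = o) := by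
  rw [Feynman.graph, Digraph.toSimpleGraphInclusive, SimpleGraph.fromRel_adj, h.digraph_adj,
    h.digraph_adj, h.vert_bijective.1.ne_iff]

/-- Reaching `none` under iteration passes across each edge in both directions, because an edge
joins a vertex to its parent. It therefore spreads from the `u`-source along walks and excludes
cycles of the parent map. -/
theorem hasDepth_of_connected (h : IsPres D par ub uu) (hD : D.Connected) : HasDepth par := by
  refine hasDepth_of_iterate fun o => ?_
  obtain ⟨p⟩ := hD.preconnected (h.vert none) (h.vert o)
  suffices H : ∀ (a b : D.Vertex) (p : D.graph.Walk a b) (o o' : Option V), h.vert o = a →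
      h.vert o' = b → (∃ k, (fun o => o.bind par)^[k] o = none) →
      ∃ k, (fun o => o.bind par)^[k] o' = none from H _ _ p none o rfl rfl ⟨0, rfl⟩
  intro a b p
  induction p with
  | nil =>
    rintro o o' rfl ho' hk
    rwa [h.vert_bijective.1 ho']
  | cons hadj p ih =>
    rename_i a c b
    rintro o o' rfl ho' ⟨k, hk⟩
    obtain ⟨o'', rfl⟩ := h.vert_bijective.2 c
    refine ih o'' o' rfl ho' ?_
    rcases ((h.graph_adj _ _).1 hadj).2 with ⟨x, rfl, rfl⟩ | ⟨x, rfl, rfl⟩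
    · cases k with
      | zero => cases hk
      | succ k => exact ⟨k, hk⟩
    · exact ⟨k + 1, hk⟩

theorem adj_par (h : IsPres D par ub uu) {dep : Option V → ℕ}
    (hdep : ∀ x, dep (some x) = dep (par x) + 1) (x : V) :
    D.graph.Adj (h.vert (some x)) (h.vert (par x)) := by
  rw [h.graph_adj]
  refine ⟨fun hx => ?_, Or.inl ⟨x, rfl, rfl⟩⟩
  have := hdep x
  rw [← hx] at this
  omega

theorem exists_walk_length_eq (h : IsPres D par ub uu) {dep : Option V → ℕ}
    (hdep0 : dep none = 0) (hdep : ∀ x, dep (some x) = dep (par x) + 1) (o : Option V) :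
    ∃ p : D.graph.Walk (h.vert o) (h.vert none), p.length = dep o := by
  induction hk : dep o generalizing o with
  | zero =>
    cases o with
    | none => exact ⟨.nil, rfl⟩
    | some x => rw [hdep] at hk; omega
  | succ k ih =>
    cases o with
    | none => omega
    | some x =>
      rw [hdep] at hk
      obtain ⟨p, hp⟩ := ih (par x) (by omega)
      exact ⟨.cons (h.adj_par hdep x) p, by rw [SimpleGraph.Walk.length_cons, hp]⟩

theorem connected_of_hasDepth (h : IsPres D par ub uu) (hpar : HasDepth par) : D.Connected := by
  obtain ⟨dep, hdep0, hdep⟩ := hpar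
  have : Nonempty D.Vertex := ⟨h.vert none⟩
  refine ⟨fun a b => ?_⟩
  obtain ⟨o, rfl⟩ := h.vert_bijective.2 a
  obtain ⟨o', rfl⟩ := h.vert_bijective.2 b
  obtain ⟨p, -⟩ := h.exists_walk_length_eq hdep0 hdep o
  obtain ⟨p', -⟩ := h.exists_walk_length_eq hdep0 hdep o'
  exact ⟨p.append p'.reverse⟩

/-- The parent path attains the depth, and no walk is shorter, since depth changes by exactly one
along each edge. -/
theorem dist_eq_dep (h : IsPres D par ub uu) {dep : Option V → ℕ}
    (hdep0 : dep none = 0) (hdep : ∀ x, dep (some x) = dep (par x) + 1) (o : Option V) :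
    D.graph.dist (h.vert o) (h.vert none) = dep o := by
  obtain ⟨p, hp⟩ := h.exists_walk_length_eq hdep0 hdep o
  refine le_antisymm (hp ▸ SimpleGraph.dist_le p) ?_
  obtain ⟨q, hq⟩ := p.reachable.exists_walk_length_eq_dist
  rw [← hq]
  suffices H : ∀ (a b : D.Vertex) (p : D.graph.Walk a b) (o o' : Option V), h.vert o = a →
      h.vert o' = b → dep o ≤ dep o' + p.length by
    simpa [hdep0] using H _ _ q o none rfl rfl
  intro a b p
  induction p with
  | nil =>
    rintro o o' rfl ho'
    rw [h.vert_bijective.1 ho']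
    omega
  | cons hadj p ih =>
    rename_i a c b
    rintro o o' rfl ho'
    obtain ⟨o'', rfl⟩ := h.vert_bijective.2 c
    have := ih o'' o' rfl ho'
    rw [SimpleGraph.Walk.length_cons]
    rcases ((h.graph_adj _ _).1 hadj).2 with ⟨x, rfl, rfl⟩ | ⟨x, rfl, rfl⟩
    · have := hdep x; omega
    · have := hdep x; omega

/-- Edge counting: the links from the elements of `V` to their parents exhaust the edges, while the
graph has one vertex more than `V`. -/
theorem isTree_of_connected (h : IsPres D par ub uu) (hD : D.Connected) : D.graph.IsTree := by
  classical
  obtain ⟨dep, hdep0, hdep⟩ := h.hasDepth_of_connected hD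
  rw [SimpleGraph.isTree_iff_connected_and_card]
  refine ⟨hD, le_antisymm ?_ hD.card_vert_le_card_edgeSet_add_one⟩
  have h1 : Nat.card D.Vertex = Nat.card V + 1 := by
    rw [← Nat.card_congr (Equiv.ofBijective _ h.vert_bijective), Finite.card_option]
  rw [h1]
  refine Nat.succ_le_succ ?_
  refine Nat.card_le_card_of_surjective
    (fun x : V => (⟨s(h.vert (some x), h.vert (par x)), h.adj_par hdep x⟩ : D.graph.edgeSet)) ?_
  rintro ⟨e, he⟩
  induction e with
  | _ a b =>
    obtain ⟨o, rfl⟩ := h.vert_bijective.2 a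
    obtain ⟨o', rfl⟩ := h.vert_bijective.2 b
    rcases ((h.graph_adj _ _).1 he).2 with ⟨x, rfl, rfl⟩ | ⟨x, rfl, rfl⟩
    · exact ⟨x, rfl⟩
    · exact ⟨x, Subtype.ext Sym2.eq_swap⟩

end Graph

end IsPres

namespace Feynman

variable {E : Type*} [Fintype E] [DecidableEq E]

/-- Connected diagrams with a single `u`-source and no `ū`-source are tree-like. -/
theorem Connected.treeLike {D : Feynman (Fin 1) Empty E} (hD : D.Connected) : D.TreeLike := by
  have h := D.isPres_parent
  obtain ⟨dep, hdep0, hdep⟩ := h.hasDepth_of_connected hD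
  refine ⟨h.vert none, fun a => ?_, h.isTree_of_connected hD, fun a b hab => ?_, fun a ha hb => ?_,
    fun a ha hb => ?_⟩
  · rw [IsPres.mem_uSources, Subtype.ext_iff, h.vert_none]
  · obtain ⟨o, rfl⟩ := h.vert_bijective.2 a
    obtain ⟨o', rfl⟩ := h.vert_bijective.2 b
    obtain ⟨x, rfl, rfl⟩ := (h.digraph_adj _ _).1 hab
    rw [h.dist_eq_dep hdep0 hdep, h.dist_eq_dep hdep0 hdep, hdep]
  · obtain ⟨o, rfl⟩ := h.vert_bijective.2 a
    obtain ⟨x, rfl⟩ := Option.ne_none_iff_exists'.1 (fun ho : o = none => ha (by rw [ho]))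
    refine Finset.mem_union_left _ ((h.mem_piY _).2 ⟨x, fun y hy => hb (h.vert (some y)) ?_, rfl⟩)
    exact (h.digraph_adj _ _).2 ⟨y, rfl, hy⟩
  · obtain ⟨o, rfl⟩ := h.vert_bijective.2 a
    obtain ⟨x, rfl⟩ := Option.ne_none_iff_exists'.1 (fun ho : o = none => ha (by rw [ho]))
    obtain ⟨b, hb⟩ := hb
    obtain ⟨o, rfl⟩ := h.vert_bijective.2 b
    obtain ⟨y, rfl, hy⟩ := (h.digraph_adj _ _).1 hb
    refine ⟨(h.mem_piH _).2 ⟨x, ⟨y, hy⟩, rfl⟩, ?_⟩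
    have h1 : 0 < ({y | D.parent y = some x} : Finset _).card :=
      Finset.card_pos.2 ⟨y, by simpa using hy⟩
    have h2 := h.card_children_ne_one x
    obtain ⟨y', hy', hne⟩ := Finset.exists_mem_ne
      (show 1 < ({y | D.parent y = some x} : Finset _).card by omega) y
    refine ⟨h.vert (some y), h.vert (some y'), ?_, hb, (h.digraph_adj _ _).2 ⟨y', rfl, ?_⟩⟩
    · rw [h.vert_bijective.1.ne_iff]
      exact fun hyy => hne (Option.some_inj.1 hyy).symm
    · simpa using hy'

/-- The `u`-source is never a leaf, since its half-line is contracted with some `ū`-half-line; any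
other vertex without children is a `Y`-vertex. -/
theorem leavesAreY (D : Feynman (Fin 1) Empty E) : D.LeavesAreY := by
  intro a ha
  have h := D.isPres_parent
  obtain ⟨o, rfl⟩ := h.vert_bijective.2 a
  cases o with
  | none =>
    obtain ⟨r, hr⟩ := h.exists_root
    exact absurd ((h.digraph_adj _ _).2 ⟨r, rfl, hr⟩) (ha _)
  | some x =>
    exact (h.mem_piY _).2 ⟨x, fun y hy => ha (h.vert (some y))
      ((h.digraph_adj _ _).2 ⟨y, rfl, hy⟩), rfl⟩

end Feynman

/-! ### Isomorphisms and parent maps -/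

section Iso

theorem par_eq_some_iff_of_comm {V V' : Type*} {par : V → Option V} {par' : V' → Option V'}
    {e : V ≃ V'} (he : ∀ x, par' (e x) = (par x).map e) (x y : V) :
    par' (e y) = some (e x) ↔ par y = some x := by
  rw [he, Option.map_eq_some_iff]
  constructor
  · rintro ⟨z, hz, hzx⟩
    rwa [← e.injective hzx]
  · exact fun hy => ⟨x, hy, rfl⟩

variable {E E' : Type*} [Fintype E] [DecidableEq E] [Fintype E'] [DecidableEq E']
  {V V' : Type*} [Fintype V] [DecidableEq V] [Fintype V'] [DecidableEq V']
  {D : Feynman (Fin 1) Empty E} {par : V → Option V} {ub uu : V → E}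
  {D' : Feynman (Fin 1) Empty E'} {par' : V' → Option V'} {ub' uu' : V' → E'}

namespace IsPres

/-- The bijection of half-lines induced by a bijection of vertices. -/
def halfLineMap (h : IsPres D par ub uu) (h' : IsPres D' par' ub' uu') (e : V ≃ V') : E ≃ E' :=
  h.halfLineEquiv.symm.trans ((Equiv.sumCongr e e).trans h'.halfLineEquiv)

@[simp] theorem halfLineMap_ub (h : IsPres D par ub uu) (h' : IsPres D' par' ub' uu') (e : V ≃ V')
    (x : V) : h.halfLineMap h' e (ub x) = ub' (e x) := by
  simp [halfLineMap]

@[simp] theorem halfLineMap_uu (h : IsPres D par ub uu) (h' : IsPres D' par' ub' uu') (e : V ≃ V')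
    (x : V) : h.halfLineMap h' e (uu x) = uu' (e x) := by
  simp [halfLineMap]

theorem map_block (h : IsPres D par ub uu) (h' : IsPres D' par' ub' uu') {e : V ≃ V'}
    (he : ∀ x, par' (e x) = (par x).map e) (x : V) :
    (block par ub uu x).map (h.halfLineMap h' e).toEmbedding = block par' ub' uu' (e x) := by
  ext y
  rw [Finset.mem_map, mem_block]
  constructor
  · rintro ⟨z, hz, rfl⟩
    rcases mem_block.1 hz with rfl | ⟨w, hw, rfl⟩
    · exact Or.inl (h.halfLineMap_ub h' e x)
    · exact Or.inr ⟨e w, (par_eq_some_iff_of_comm he _ _).2 hw, (h.halfLineMap_uu h' e w).symm⟩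
  · rintro (rfl | ⟨w, hw, rfl⟩)
    · exact ⟨ub x, h.ub_mem_block.2 rfl, h.halfLineMap_ub h' e x⟩
    · obtain ⟨w, rfl⟩ := e.surjective w
      exact ⟨uu w, h.uu_mem_block.2 ((par_eq_some_iff_of_comm he _ _).1 hw),
        h.halfLineMap_uu h' e w⟩

theorem rhoU_eq_halfLineMap (h : IsPres D par ub uu) (h' : IsPres D' par' ub' uu') {e : V ≃ V'}
    (he : ∀ x, par' (e x) = (par x).map e) : D'.rhoU 0 = h.halfLineMap h' e (D.rhoU 0) := by
  obtain ⟨r, hr⟩ := (h.mem_Eu _).1 D.rhoU_mem_Eu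
  rw [← hr, h.halfLineMap_uu h', eq_comm, h'.root, he, (h.root r).1 hr, Option.map_none]

theorem mem_Eint_iff (e : E) : e ∈ D.Eint ↔ e ≠ D.rhoU 0 := by
  rw [ne_eq, ← D.mem_Eext_iff]
  exact ⟨D.notMem_Eext_of_mem_Eint, (D.mem_Eint_or_mem_Eext e).resolve_right⟩

theorem isIso_halfLineMap (h : IsPres D par ub uu) (h' : IsPres D' par' ub' uu') {e : V ≃ V'}
    (he : ∀ x, par' (e x) = (par x).map e) : D.IsIso D' (h.halfLineMap h' e) where
  Eubar := by
    ext y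
    rw [Finset.mem_map, h'.mem_Eubar]
    constructor
    · rintro ⟨x, rfl⟩
      obtain ⟨x, rfl⟩ := e.surjective x
      exact ⟨ub x, h.ub_mem x, h.halfLineMap_ub h' e x⟩
    · rintro ⟨z, hz, rfl⟩
      obtain ⟨x, rfl⟩ := (h.mem_Eubar z).1 hz
      exact ⟨e x, (h.halfLineMap_ub h' e x).symm⟩
  Eu := by
    ext y
    rw [Finset.mem_map, h'.mem_Eu]
    constructor
    · rintro ⟨x, rfl⟩
      obtain ⟨x, rfl⟩ := e.surjective x
      exact ⟨uu x, h.uu_mem x, h.halfLineMap_uu h' e x⟩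
    · rintro ⟨z, hz, rfl⟩
      obtain ⟨x, rfl⟩ := (h.mem_Eu z).1 hz
      exact ⟨e x, (h.halfLineMap_uu h' e x).symm⟩
  Eint := by
    ext y
    rw [Finset.mem_map_equiv, mem_Eint_iff, mem_Eint_iff, h.rhoU_eq_halfLineMap h' he, ne_eq,
      ne_eq, Equiv.symm_apply_eq]
  Eext := by
    ext y
    rw [Finset.mem_map_equiv, D.mem_Eext_iff, D'.mem_Eext_iff, h.rhoU_eq_halfLineMap h' he,
      Equiv.symm_apply_eq]
  piH := by
    ext B
    rw [Finset.mem_map, h'.mem_piH]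
    constructor
    · rintro ⟨x, ⟨y, hy⟩, rfl⟩
      obtain ⟨x, rfl⟩ := e.surjective x
      obtain ⟨y, rfl⟩ := e.surjective y
      exact ⟨_, (h.mem_piH _).2 ⟨x, ⟨y, (par_eq_some_iff_of_comm he _ _).1 hy⟩, rfl⟩,
        h.map_block h' he x⟩
    · rintro ⟨B, hB, rfl⟩
      obtain ⟨x, ⟨y, hy⟩, rfl⟩ := (h.mem_piH B).1 hB
      exact ⟨e x, ⟨e y, (par_eq_some_iff_of_comm he _ _).2 hy⟩, h.map_block h' he x⟩
  piY := by
    ext B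
    rw [Finset.mem_map, h'.mem_piY]
    constructor
    · rintro ⟨x, hx, rfl⟩
      obtain ⟨x, rfl⟩ := e.surjective x
      exact ⟨_, (h.mem_piY _).2 ⟨x, fun y hy => hx (e y) ((par_eq_some_iff_of_comm he _ _).2 hy),
        rfl⟩, h.map_block h' he x⟩
    · rintro ⟨B, hB, rfl⟩
      obtain ⟨x, hx, rfl⟩ := (h.mem_piY B).1 hB
      refine ⟨e x, fun y hy => ?_, h.map_block h' he x⟩
      obtain ⟨y, rfl⟩ := e.surjective y
      exact hx y ((par_eq_some_iff_of_comm he _ _).1 hy)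
  rhoU := by
    ext i
    rw [Subsingleton.elim i 0]
    exact h.rhoU_eq_halfLineMap h' he
  rhoUbar := by
    ext i
    exact i.elim
  contr := by
    rintro ⟨x, hx⟩ ⟨y, hy⟩ hxy
    obtain ⟨x, rfl⟩ := (h.mem_Eubar x).1 hx
    simp only [halfLineMap_ub] at hxy
    subst hxy
    rw [h.contr, h'.contr, h.halfLineMap_uu h']

/-- An isomorphism acts on vertices through their `ū`-half-lines. Compatibility with contractions
determines it on the `u`-half-lines, and transport of the external half-line and of the `H`-vertices
makes the action commute with parents. -/
theorem exists_halfLineMap_eq (h : IsPres D par ub uu) (h' : IsPres D' par' ub' uu')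
    {σ : E ≃ E'} (hσ : D.IsIso D' σ) :
    ∃ e : V ≃ V', (∀ x, par' (e x) = (par x).map e) ∧ h.halfLineMap h' e = σ := by
  have hub : ∀ x, ∃ x', ub' x' = σ (ub x) := fun x => by
    rw [← h'.mem_Eubar, hσ.Eubar]
    exact Finset.mem_map_of_mem _ (h.ub_mem x)
  choose f hf using hub
  have huu : ∀ x, uu' (f x) = σ (uu x) := fun x => by
    rw [← h'.contr _ (h'.ub_mem _), ← h.contr _ (h.ub_mem _)]
    exact hσ.contr _ _ (hf x).symm
  have hbij : Function.Bijective f := by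
    constructor
    · intro x y hxy
      refine h.ub_inj (σ.injective ?_)
      rw [← hf, ← hf, hxy]
    · intro x'
      have : ub' x' ∈ D.Eubar.map σ.toEmbedding := hσ.Eubar ▸ h'.ub_mem x'
      obtain ⟨z, hz, hzx⟩ := Finset.mem_map.1 this
      obtain ⟨x, rfl⟩ := (h.mem_Eubar z).1 hz
      exact ⟨x, h'.ub_inj ((hf x).trans hzx)⟩
  refine ⟨Equiv.ofBijective f hbij, fun y => ?_, ?_⟩
  · change par' (f y) = (par y).map f
    cases hy : par y with
    | none =>
      rw [Option.map_none, ← h'.root, huu, (h.root y).2 hy, hσ.rhoU]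
      rfl
    | some x =>
      have hB := (h.mem_piH _).2 ⟨x, ⟨y, hy⟩, rfl⟩
      have hB' : (block par ub uu x).map σ.toEmbedding ∈ D'.piH := by
        rw [hσ.piH, Finset.mem_map]
        exact ⟨_, hB, rfl⟩
      obtain ⟨x', -, hx'⟩ := (h'.mem_piH _).1 hB'
      have h1 : ub' (f x) ∈ block par' ub' uu' x' := by
        rw [← hx', hf]
        exact Finset.mem_map_of_mem _ (h.ub_mem_block.2 rfl)
      have h2 : uu' (f y) ∈ block par' ub' uu' x' := by
        rw [← hx', huu]
        exact Finset.mem_map_of_mem _ (h.uu_mem_block.2 hy)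
      rw [h'.uu_mem_block.1 h2, ← h'.ub_mem_block.1 h1]
      rfl
  · ext z
    obtain ⟨z, rfl⟩ := h.halfLineEquiv.surjective z
    cases z with
    | inl x => exact (h.halfLineMap_ub h' _ x).trans (hf x)
    | inr x => exact (h.halfLineMap_uu h' _ x).trans (huu x)

/-- Isomorphisms of diagrams are the bijections of vertices that commute with the parent maps. -/
theorem card_isIso (h : IsPres D par ub uu) (h' : IsPres D' par' ub' uu') :
    Nat.card {σ : E ≃ E' // D.IsIso D' σ} =
      Nat.card {e : V ≃ V' // ∀ x, par' (e x) = (par x).map e} := by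
  refine (Nat.card_eq_of_bijective
    (fun e : {e : V ≃ V' // ∀ x, par' (e x) = (par x).map e} =>
      (⟨h.halfLineMap h' e.1, h.isIso_halfLineMap h' e.2⟩ : {σ : E ≃ E' // D.IsIso D' σ}))
    ⟨?_, ?_⟩).symm
  · intro e e' hee
    refine Subtype.ext (Equiv.ext fun x => h'.ub_inj ?_)
    rw [← h.halfLineMap_ub h', ← h.halfLineMap_ub h']
    exact DFunLike.congr_fun (Subtype.ext_iff.1 hee) (ub x)
  · rintro ⟨σ, hσ⟩
    obtain ⟨e, he, rfl⟩ := h.exists_halfLineMap_eq h' hσ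
    exact ⟨⟨e, he⟩, rfl⟩

end IsPres

end Iso

/-! ### The diagram of a parent map -/

section OfParent

variable {E : Type*} [Fintype E] [DecidableEq E] {V : Type*} [Fintype V] [DecidableEq V]

/-- Converse of `Feynman.isPres_parent`: a parent map with one root and no vertex with exactly one
child is realized on two copies of `V`. No depth condition is needed, as connectedness is not
asserted. -/
theorem exists_isPres {par : V → Option V} {r : V} (hr : ∀ x, par x = none ↔ x = r)
    (hpar : ∀ x, ({y | par y = some x} : Finset V).card ≠ 1) (f : V ⊕ V ≃ E) :
    ∃ D : Feynman (Fin 1) Empty E, IsPres D par (fun x => f (Sum.inl x)) fun x => f (Sum.inr x) := by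
  classical
  set ub : V → E := fun x => f (Sum.inl x) with hub
  set uu : V → E := fun x => f (Sum.inr x) with huu
  have ubi : Function.Injective ub := fun x y h => Sum.inl_injective (f.injective h)
  have uui : Function.Injective uu := fun x y h => Sum.inr_injective (f.injective h)
  have hne : ∀ x y, ub x ≠ uu y := fun x y h => by simpa using f.injective h
  have hcases : ∀ e, (∃ x, uu x = e) ∨ ∃ x, ub x = e := fun e => by
    obtain ⟨x | x, rfl⟩ := f.surjective e
    · exact Or.inr ⟨x, rfl⟩
    · exact Or.inl ⟨x, rfl⟩
  have hubB : ∀ x y, ub y ∈ block par ub uu x ↔ y = x := fun x y => by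
    rw [mem_block]
    constructor
    · rintro (hy | ⟨z, -, hz⟩)
      · exact ubi hy
      · exact absurd hz.symm (hne _ _)
    · rintro rfl
      exact Or.inl rfl
  have huuB : ∀ x y, uu y ∈ block par ub uu x ↔ par y = some x := fun x y => by
    rw [mem_block]
    constructor
    · rintro (hy | ⟨z, hz, hzy⟩)
      · exact absurd hy.symm (hne _ _)
      · rwa [← uui hzy]
    · exact fun hy => Or.inr ⟨y, hy, rfl⟩
  have hBub : ∀ x, block par ub uu x ∩ univ.image ub = {ub x} := fun x => by
    ext e
    simp only [Finset.mem_inter, Finset.mem_image, Finset.mem_univ, true_and,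
      Finset.mem_singleton]
    constructor
    · rintro ⟨he, y, rfl⟩
      rw [(hubB _ _).1 he]
    · rintro rfl
      exact ⟨(hubB _ _).2 rfl, x, rfl⟩
  have hBuu : ∀ x, block par ub uu x ∩ univ.image uu =
      ({y | par y = some x} : Finset V).image uu := fun x => by
    ext e
    simp only [Finset.mem_inter, Finset.mem_image, Finset.mem_univ, true_and, Finset.mem_filter]
    constructor
    · rintro ⟨he, y, rfl⟩
      exact ⟨y, (huuB _ _).1 he, rfl⟩
    · rintro ⟨y, hy, rfl⟩
      exact ⟨(huuB _ _).2 hy, y, rfl⟩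
  have hinj : Function.Injective (block par ub uu) := fun x y hxy =>
    (hubB y x).1 (hxy ▸ (hubB x x).2 rfl)
  let piH : Finset (Finset E) := ({x | ∃ y, par y = some x} : Finset V).image (block par ub uu)
  let piY : Finset (Finset E) := ({x | ∀ y, par y ≠ some x} : Finset V).image (block par ub uu)
  have hparts : ∀ B, B ∈ piH ∪ piY ↔ ∃ x, block par ub uu x = B := fun B => by
    simp only [piH, piY, Finset.mem_union, Finset.mem_image, Finset.mem_filter, Finset.mem_univ,
      true_and]
    constructor
    · rintro (⟨x, -, rfl⟩ | ⟨x, -, rfl⟩) <;> exact ⟨x, rfl⟩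
    · rintro ⟨x, rfl⟩
      by_cases hx : ∃ y, par y = some x
      · exact Or.inl ⟨x, hx, rfl⟩
      · exact Or.inr ⟨x, not_exists.1 hx, rfl⟩
  let eub : V ≃ {e // e ∈ univ.image ub} := Equiv.ofBijective
    (fun x => ⟨ub x, Finset.mem_image_of_mem _ (Finset.mem_univ x)⟩)
    ⟨fun x y h => ubi (Subtype.ext_iff.1 h), fun ⟨e, he⟩ => by
      obtain ⟨x, -, rfl⟩ := Finset.mem_image.1 he
      exact ⟨x, rfl⟩⟩
  let euu : V ≃ {e // e ∈ univ.image uu} := Equiv.ofBijective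
    (fun x => ⟨uu x, Finset.mem_image_of_mem _ (Finset.mem_univ x)⟩)
    ⟨fun x y h => uui (Subtype.ext_iff.1 h), fun ⟨e, he⟩ => by
      obtain ⟨x, -, rfl⟩ := Finset.mem_image.1 he
      exact ⟨x, rfl⟩⟩
  let D : Feynman (Fin 1) Empty E :=
    { Eubar := univ.image ub
      Eu := univ.image uu
      -- The half-line contracted with the `ū`-half-line of the root is the only external one.
      Eint := {uu r}ᶜ
      Eext := {uu r}
      piH := piH
      piY := piY
      rhoU := fun _ => uu r
      rhoUbar := Empty.elim
      isCompl_u_ubar := by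
        rw [isCompl_iff, Finset.disjoint_left, codisjoint_iff, Finset.sup_eq_union,
          Finset.top_eq_univ, Finset.eq_univ_iff_forall]
        refine ⟨fun e he he' => ?_, fun e => ?_⟩
        · obtain ⟨x, -, rfl⟩ := Finset.mem_image.1 he
          obtain ⟨y, -, hy⟩ := Finset.mem_image.1 he'
          exact hne _ _ hy
        · simpa using hcases e
      isCompl_int_ext := isCompl_compl.symm
      bijOn_rhoU := by
        refine ⟨fun i _ => ?_, fun i _ j _ _ => Subsingleton.elim i j, fun e he => ?_⟩
        · simp
        · simp only [Finset.coe_inter, Finset.coe_singleton, Set.mem_inter_iff,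
            Set.mem_singleton_iff] at he
          exact ⟨0, trivial, he.1.symm⟩
      bijOn_rhoUbar := by
        refine ⟨fun i => i.elim, fun i => i.elim, fun e he => ?_⟩
        simp only [Finset.mem_coe, Finset.mem_inter, Finset.mem_singleton, Finset.mem_image] at he
        obtain ⟨rfl, y, -, hy⟩ := he
        exact absurd hy (hne _ _)
      disjoint_H_Y := by
        rw [Finset.disjoint_left]
        intro B hB hB'
        obtain ⟨x, hx, rfl⟩ := Finset.mem_image.1 hB
        obtain ⟨y, hy, hxy⟩ := Finset.mem_image.1 hB'
        rw [hinj hxy] at hy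
        obtain ⟨z, hz⟩ := (Finset.mem_filter.1 hx).2
        exact (Finset.mem_filter.1 hy).2 z hz
      partition_int := by
        refine ⟨Finpartition.ofExistsUnique (piH ∪ piY) ?_ ?_ ?_, rfl⟩
        · intro B hB e he
          obtain ⟨x, rfl⟩ := (hparts B).1 hB
          rw [Finset.mem_compl, Finset.mem_singleton]
          rintro rfl
          rw [huuB, (hr r).2 rfl] at he
          cases he
        · intro e he
          rw [Finset.mem_compl, Finset.mem_singleton] at he
          rcases hcases e with ⟨y, rfl⟩ | ⟨y, rfl⟩
          · have hy : par y ≠ none := fun hy => he (by rw [(hr y).1 hy])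
            obtain ⟨x, hx⟩ := Option.ne_none_iff_exists'.1 hy
            refine ⟨block par ub uu x, ⟨(hparts _).2 ⟨x, rfl⟩, (huuB _ _).2 hx⟩, ?_⟩
            rintro B ⟨hB, hyB⟩
            obtain ⟨x', rfl⟩ := (hparts B).1 hB
            rw [huuB, hx, Option.some_inj] at hyB
            rw [hyB]
          · refine ⟨block par ub uu y, ⟨(hparts _).2 ⟨y, rfl⟩, (hubB _ _).2 rfl⟩, ?_⟩
            rintro B ⟨hB, hyB⟩
            obtain ⟨x', rfl⟩ := (hparts B).1 hB
            rw [hubB] at hyB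
            rw [hyB]
        · intro h
          obtain ⟨x, hx⟩ := (hparts _).1 h
          have := (hubB x x).2 rfl
          rw [hx] at this
          simp at this
      H_vertex := by
        intro B hB
        obtain ⟨x, hx, rfl⟩ := Finset.mem_image.1 hB
        obtain ⟨y, hy⟩ := (Finset.mem_filter.1 hx).2
        rw [hBub, hBuu, Finset.card_singleton, Finset.card_image_of_injective _ uui]
        have h1 : 0 < ({y | par y = some x} : Finset V).card :=
          Finset.card_pos.2 ⟨y, by simpa using hy⟩
        have h2 := hpar x
        exact ⟨rfl, by omega⟩
      Y_vertex := by
        intro B hB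
        obtain ⟨x, hx, rfl⟩ := Finset.mem_image.1 hB
        rw [hBub, hBuu, Finset.card_singleton, Finset.image_eq_empty]
        refine ⟨rfl, ?_⟩
        rw [Finset.filter_eq_empty_iff]
        exact fun y _ => (Finset.mem_filter.1 hx).2 y
      contr := eub.symm.trans euu }
  refine ⟨D, ubi, uui, fun e => ?_, fun e => ?_, fun x h => ?_, fun x => ?_, fun B => ?_,
    fun B => ?_⟩
  · simp [D]
  · simp [D]
  · have : eub.symm ⟨ub x, h⟩ = x := by rw [Equiv.symm_apply_eq]; rfl
    change (euu (eub.symm ⟨ub x, h⟩) : E) = uu x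
    rw [this]
    rfl
  · rw [hr]
    exact uui.eq_iff
  · simp [D, piH, eq_comm]
  · simp [D, piY, eq_comm]

end OfParent

/-! ### Amplitudes in terms of parent maps -/

section Amplitude

variable {E : Type*} [Fintype E] [DecidableEq E] {V : Type*} [Fintype V] [DecidableEq V]
  {n : ℕ} {R : Type*} [CommRing R] (F : Fin n → MvPowerSeries (Fin n) R)

/-- The contribution of the indices `a` of the `ū`-half-lines and `b` of the `u`-half-lines to the
amplitude of the diagram of a parent map. -/
def indexTerm (par : V → Option V) (a b : V → Fin n) : MvPowerSeries (Fin n) R :=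
  (∏ x, C ((linMatrix F)⁻¹ (b x) (a x))) *
    ∏ x, vertexFactor F (a x) (∑ y, if par y = some x then Finsupp.single (b y) 1 else 0)

/-- The amplitude of the diagram of a parent map. -/
def parAmplitude (par : V → Option V) (r : V) (i : Fin n) : MvPowerSeries (Fin n) R :=
  ∑ p : (V → Fin n) × (V → Fin n), if p.2 r = i then indexTerm F par p.1 p.2 else 0

theorem sum_children_eq_zero_iff (par : V → Option V) (b : V → Fin n) (x : V) :
    (∑ y, if par y = some x then Finsupp.single (b y) 1 else (0 : Fin n →₀ ℕ)) = 0 ↔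
      ∀ y, par y ≠ some x := by
  rw [Finset.sum_eq_zero_iff]
  simp

/-- Indices on half-lines split into indices on the two copies of `V`, and the products over `H`-
and `Y`-vertices merge into one, the case distinction of `vertexFactor` being whether the vertex has
children. -/
theorem IsPres.amplitude_eq {D : Feynman (Fin 1) Empty E} {par : V → Option V} {ub uu : V → E}
    (h : IsPres D par ub uu) {r : V} (hr : par r = none) (i : Fin n) :
    D.amplitude F (fun _ => i) (Empty.elim : Empty → Fin n) = parAmplitude F par r i := by
  classical
  have hroot : D.rhoU 0 = uu r := ((h.root r).2 hr).symm
  unfold Feynman.amplitude parAmplitude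
  rw [Finset.sum_filter]
  let Φ : (E → Fin n) ≃ (V → Fin n) × (V → Fin n) :=
    (Equiv.arrowCongr h.halfLineEquiv.symm (Equiv.refl _)).trans (Equiv.sumArrowEquivProdArrow V V _)
  refine Fintype.sum_equiv Φ _ _ fun α => ?_
  have hΦ1 : ∀ x, (Φ α).1 x = α (ub x) := fun x => rfl
  have hΦ2 : ∀ x, (Φ α).2 x = α (uu x) := fun x => rfl
  have hatt : D.IsAttribution (fun _ => i) (Empty.elim : Empty → Fin n) α ↔ (Φ α).2 r = i := by
    rw [hΦ2, ← hroot]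
    constructor
    · exact fun hα => hα.1 0
    · refine fun hα => ⟨fun j => ?_, fun j => j.elim⟩
      rw [Subsingleton.elim j 0]
      exact hα
  simp only [hatt]
  split_ifs with hi
  swap
  · rfl
  rw [indexTerm, mul_assoc]
  congr 1
  · symm
    refine Fintype.prod_bijective (fun x : V => (⟨ub x, h.ub_mem x⟩ : {e // e ∈ D.Eubar}))
      ⟨fun x y hxy => h.ub_inj (Subtype.ext_iff.1 hxy), fun ⟨e, he⟩ => ?_⟩ _ _ fun x => ?_
    · obtain ⟨x, rfl⟩ := (h.mem_Eubar e).1 he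
      exact ⟨x, rfl⟩
    · rw [h.contr, hΦ1, hΦ2]
  · have hH : D.piH = ({x | ∃ y, par y = some x} : Finset V).image (block par ub uu) := by
      ext B; simp [h.mem_piH, eq_comm]
    have hY : D.piY = ({x | ¬ ∃ y, par y = some x} : Finset V).image (block par ub uu) := by
      ext B; simp [h.mem_piY, eq_comm]
    rw [hH, hY, Finset.prod_image h.block_inj.injOn, Finset.prod_image h.block_inj.injOn,
      ← Finset.prod_filter_mul_prod_filter_not univ (fun x => ∃ y, par y = some x)]
    congr 1
    · refine Finset.prod_congr rfl fun x hx => ?_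
      obtain ⟨y, hy⟩ := (Finset.mem_filter.1 hx).2
      rw [vertexFactor, if_neg, Feynman.hVertex, h.block_inter_Eubar, Finset.prod_singleton,
        h.block_inter_Eu, Finset.sum_image h.uu_inj.injOn, Finset.sum_filter]
      · rfl
      · rw [sum_children_eq_zero_iff]
        exact fun h0 => h0 y hy
    · refine Finset.prod_congr rfl fun x hx => ?_
      rw [vertexFactor, if_pos, Feynman.yVertex, h.block_inter_Eubar, Finset.prod_singleton]
      · rfl
      · rw [sum_children_eq_zero_iff]
        exact not_exists.1 (Finset.mem_filter.1 hx).2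

end Amplitude

/-! ### The positions of a planar tree -/

namespace PTree

/-- The vertices of a planar tree. -/
def Pos : PTree → Type
  | mk d ch => Option (Σ k : Fin d, Pos (ch k))

instance instFintypePos : (t : PTree) → Fintype t.Pos
  | mk d ch =>
    letI : ∀ k, Fintype (ch k).Pos := fun k => instFintypePos (ch k)
    inferInstanceAs (Fintype (Option (Σ k : Fin d, (ch k).Pos)))

instance instDecidableEqPos : (t : PTree) → DecidableEq t.Pos
  | mk d ch =>
    letI : ∀ k, DecidableEq (ch k).Pos := fun k => instDecidableEqPos (ch k)
    inferInstanceAs (DecidableEq (Option (Σ k : Fin d, (ch k).Pos)))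

/-- The root of a planar tree. -/
def root : (t : PTree) → t.Pos
  | mk _ _ => none

/-- The vertex `x` of the `k`-th branch of a planar tree. -/
def sub {d : {d : ℕ // d ≠ 1}} (ch : Fin d → PTree) (k : Fin d) (x : (ch k).Pos) :
    (mk d ch).Pos :=
  some ⟨k, x⟩

/-- The parent map of a planar tree. -/
def par : (t : PTree) → t.Pos → Option t.Pos
  | mk _ _, none => none
  | mk d ch, some ⟨k, x⟩ => some (((ch k).par x).elim (mk d ch).root (sub ch k))

section Branches

variable {d : {d : ℕ // d ≠ 1}} (ch : Fin d → PTree)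

theorem eq_root_or_eq_sub (x : (mk d ch).Pos) : x = (mk d ch).root ∨ ∃ k y, x = sub ch k y := by
  cases x with
  | none => exact Or.inl rfl
  | some p => exact Or.inr ⟨p.1, p.2, rfl⟩

theorem sub_ne_root (k : Fin d) (x : (ch k).Pos) : sub ch k x ≠ (mk d ch).root := by
  intro h
  cases h

theorem sub_injective (k : Fin d) : Function.Injective (sub ch k) := by
  intro x y h
  cases h
  rfl

theorem sub_ne_sub {k k' : Fin d} (hk : k ≠ k') (x : (ch k).Pos) (y : (ch k').Pos) :
    sub ch k x ≠ sub ch k' y := by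
  intro h
  cases h
  exact hk rfl

theorem par_root : (mk d ch).par (mk d ch).root = none := rfl

theorem par_sub (k : Fin d) (x : (ch k).Pos) :
    (mk d ch).par (sub ch k x) = some (((ch k).par x).elim (mk d ch).root (sub ch k)) := rfl

theorem prod_pos {M : Type*} [CommMonoid M] (f : (mk d ch).Pos → M) :
    ∏ x, f x = f (mk d ch).root * ∏ k, ∏ x, f (sub ch k x) := by
  rw [← Fintype.prod_sigma' fun k x => f (sub ch k x)]
  exact Fintype.prod_option (α := Σ k : Fin d, (ch k).Pos) f

theorem sum_pos {M : Type*} [AddCommMonoid M] (f : (mk d ch).Pos → M) :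
    ∑ x, f x = f (mk d ch).root + ∑ k, ∑ x, f (sub ch k x) := by
  rw [← Fintype.sum_sigma' fun k x => f (sub ch k x)]
  exact Fintype.sum_option (α := Σ k : Fin d, (ch k).Pos) f

end Branches

theorem par_eq_none_iff (t : PTree) (x : t.Pos) : t.par x = none ↔ x = t.root := by
  cases t with
  | mk d ch =>
    rcases eq_root_or_eq_sub ch x with rfl | ⟨k, y, rfl⟩
    · simp [par_root]
    · simp [par_sub, sub_ne_root]

section Branches

variable {d : {d : ℕ // d ≠ 1}} (ch : Fin d → PTree)

theorem par_sub_eq_root_iff (k : Fin d) (x : (ch k).Pos) :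
    (mk d ch).par (sub ch k x) = some (mk d ch).root ↔ x = (ch k).root := by
  rw [par_sub, Option.some_inj, ← (ch k).par_eq_none_iff x]
  cases (ch k).par x with
  | none => simp
  | some y => simp [sub_ne_root]

theorem par_sub_eq_sub_iff (k : Fin d) (x y : (ch k).Pos) :
    (mk d ch).par (sub ch k x) = some (sub ch k y) ↔ (ch k).par x = some y := by
  rw [par_sub, Option.some_inj]
  cases (ch k).par x with
  | none => simp [(sub_ne_root ch k y).symm]
  | some z => simp [(sub_injective ch k).eq_iff]

theorem par_sub_ne_sub {k k' : Fin d} (hk : k ≠ k') (x : (ch k).Pos) (y : (ch k').Pos) :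
    (mk d ch).par (sub ch k x) ≠ some (sub ch k' y) := by
  rw [par_sub, ne_eq, Option.some_inj]
  cases (ch k).par x with
  | none => exact (sub_ne_root ch k' y).symm
  | some z => exact sub_ne_sub ch hk z y

end Branches

theorem hasDepth_par (t : PTree) : HasDepth t.par := by
  induction t with
  | mk d ch ih =>
    choose dep h0 hdep using ih
    -- The root of the tree has depth 1, depth 0 being reserved for `none`, so depths in the
    -- branches increase by one.
    let f : (mk d ch).Pos → ℕ := fun o => Option.elim (α := Σ k : Fin d, (ch k).Pos) o 1
      fun p => dep p.1 (some p.2) + 1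
    refine ⟨fun o => o.elim 0 f, rfl, fun x => ?_⟩
    rcases eq_root_or_eq_sub ch x with rfl | ⟨k, y, rfl⟩
    · rfl
    · rw [par_sub]
      change dep k (some y) + 1 = f (((ch k).par y).elim (mk d ch).root (sub ch k)) + 1
      rw [hdep]
      cases (ch k).par y with
      | none => rw [h0]; rfl
      | some z => rfl

section Amp

variable {n : ℕ} {R : Type*} [CommRing R] (F : Fin n → MvPowerSeries (Fin n) R)
  {d : {d : ℕ // d ≠ 1}} (ch : Fin d → PTree)

theorem sum_children_root {M : Type*} [AddCommMonoid M] (f : (mk d ch).Pos → M) :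
    (∑ y, if (mk d ch).par y = some (mk d ch).root then f y else 0) =
      ∑ k, f (sub ch k (ch k).root) := by
  rw [sum_pos, par_root]
  simp [par_sub_eq_root_iff]

theorem sum_children_sub {M : Type*} [AddCommMonoid M] (f : (mk d ch).Pos → M) (k : Fin d)
    (x : (ch k).Pos) :
    (∑ y, if (mk d ch).par y = some (sub ch k x) then f y else 0) =
      ∑ y, if (ch k).par y = some x then f (sub ch k y) else 0 := by
  rw [sum_pos, par_root, Finset.sum_eq_single k]
  · simp [par_sub_eq_sub_iff]
  · intro k' _ hk
    exact Finset.sum_eq_zero fun y _ => if_neg (par_sub_ne_sub ch hk y x)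
  · simp

theorem card_children_ne_one (t : PTree) (x : t.Pos) :
    ({y | t.par y = some x} : Finset t.Pos).card ≠ 1 := by
  induction t with
  | mk d ch ih =>
    rw [Finset.card_filter]
    rcases eq_root_or_eq_sub ch x with rfl | ⟨k, y, rfl⟩
    · rw [sum_children_root]
      simpa using d.2
    · rw [sum_children_sub, ← Finset.card_filter]
      exact ih k y

theorem indexTerm_mk (a b : (mk d ch).Pos → Fin n) :
    indexTerm F (mk d ch).par a b =
      C ((linMatrix F)⁻¹ (b (mk d ch).root) (a (mk d ch).root)) *
        (vertexFactor F (a (mk d ch).root) (mult fun k => b (sub ch k (ch k).root)) *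
        ∏ k, indexTerm F (ch k).par (fun x => a (sub ch k x)) fun x => b (sub ch k x)) := by
  simp only [indexTerm, prod_pos, sum_children_root, sum_children_sub, Finset.prod_mul_distrib]
  rw [mult]
  ring

/-- Functions on a tree, in terms of their values at the root and on the branches. -/
def funEquiv (X : Type*) : ((mk d ch).Pos → X) ≃ X × ∀ k, (ch k).Pos → X where
  toFun a := (a (mk d ch).root, fun k x => a (sub ch k x))
  invFun p := fun o => Option.elim (α := Σ k : Fin d, (ch k).Pos) o p.1 fun q => p.2 q.1 q.2
  left_inv a := by
    ext x
    rcases eq_root_or_eq_sub ch x with rfl | ⟨k, y, rfl⟩ <;> rfl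
  right_inv _ := rfl

/-- Pairs of functions on a tree, in terms of their values at the root and on the branches. -/
def pairEquiv (X : Type*) : ((mk d ch).Pos → X) × ((mk d ch).Pos → X) ≃
    X × X × ∀ k, ((ch k).Pos → X) × ((ch k).Pos → X) where
  toFun p := (p.1 (mk d ch).root, p.2 (mk d ch).root,
    fun k => (fun x => p.1 (sub ch k x), fun x => p.2 (sub ch k x)))
  invFun q := ((funEquiv ch X).symm (q.1, fun k => (q.2.2 k).1),
    (funEquiv ch X).symm (q.2.1, fun k => (q.2.2 k).2))
  left_inv p := Prod.ext ((funEquiv ch X).symm_apply_apply p.1)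
    ((funEquiv ch X).symm_apply_apply p.2)
  right_inv _ := rfl

/-- Distributivity: the global sum over indices factors through the branches once the indices on the
`u`-half-lines of the branch roots are fixed. -/
theorem parAmplitude_eq_amp (t : PTree) (i : Fin n) :
    parAmplitude F t.par t.root i = t.amp F i := by
  classical
  induction t generalizing i with
  | mk d ch ih =>
    have h1 : parAmplitude F (mk d ch).par (mk d ch).root i =
        ∑ q : Fin n × Fin n × ∀ k, ((ch k).Pos → Fin n) × ((ch k).Pos → Fin n),
          if q.2.1 = i then C ((linMatrix F)⁻¹ q.2.1 q.1) *
            (vertexFactor F q.1 (mult fun k => (q.2.2 k).2 (ch k).root) *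
              ∏ k, indexTerm F (ch k).par (q.2.2 k).1 (q.2.2 k).2) else 0 := by
      refine Fintype.sum_equiv (pairEquiv ch (Fin n)) _ _ fun p => ?_
      rw [indexTerm_mk]
      rfl
    rw [h1, amp, Fintype.sum_prod_type]
    refine Finset.sum_congr rfl fun l _ => ?_
    rw [Fintype.sum_prod_type, Finset.sum_eq_single i]
    rotate_left
    · intro j _ hj
      exact Finset.sum_eq_zero fun q _ => if_neg hj
    · simp
    simp only [if_true, ← Finset.mul_sum]
    congr 1
    simp only [← ih, parAmplitude, Finset.prod_univ_sum, Fintype.piFinset_univ, Finset.mul_sum]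
    rw [Finset.sum_comm]
    refine Finset.sum_congr rfl fun q _ => ?_
    -- For given indices on the branches, the only surviving `ks` records their values at the branch
    -- roots.
    rw [Finset.sum_eq_single fun k => (q k).2 (ch k).root]
    · simp
    · intro ks _ hks
      obtain ⟨k, hk⟩ := Function.ne_iff.1 hks
      rw [Finset.prod_eq_zero (Finset.mem_univ k) (if_neg (Ne.symm hk)), mul_zero]
    · simp

end Amp
end PTree

/-! ### Coverings by planar trees -/

section Covering

variable {V : Type*}

/-- The maps from the planar tree `t` that send its root to `v` and are bijective on the children
of every vertex. -/
def Covering (t : PTree) (par : V → Option V) (v : V) : Type _ :=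
  {e : t.Pos → V // e t.root = v ∧
    ∀ x, Set.BijOn e {y | t.par y = some x} {y | par y = some (e x)}}

instance [Finite V] (t : PTree) (par : V → Option V) (v : V) : Finite (Covering t par v) :=
  Subtype.finite

variable {par : V → Option V}

theorem Covering.par_eq {t : PTree} {r : V} (hr : par r = none) (e : Covering t par r)
    (x : t.Pos) : par (e.1 x) = (t.par x).map e.1 := by
  cases hx : t.par x with
  | none => rw [(t.par_eq_none_iff x).1 hx, e.2.1, hr]; rfl
  | some z => exact (e.2.2 z).mapsTo hx

/-- Induction on depth: equal images have equal parent images, so the parents agree, and the map is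
injective on the children of a common parent. -/
theorem Covering.injective {t : PTree} {r : V} (hr : par r = none) (e : Covering t par r) :
    Function.Injective e.1 := by
  obtain ⟨dep, -, hdep⟩ := t.hasDepth_par
  intro x
  induction hk : dep (some x) using Nat.strong_induction_on generalizing x with
  | _ k ih =>
    intro y hxy
    have h := e.par_eq hr x
    rw [hxy, e.par_eq hr y] at h
    cases hx : t.par x with
    | none =>
      rw [hx, Option.map_none, Option.map_eq_none_iff] at h
      rw [(t.par_eq_none_iff x).1 hx, (t.par_eq_none_iff y).1 h]
    | some z =>
      rw [hx, Option.map_some, Option.map_eq_some_iff] at h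
      obtain ⟨z', hz', hzz⟩ := h
      have h1 := hdep x
      rw [hx] at h1
      obtain rfl := ih (dep (some z)) (by omega) rfl hzz.symm
      exact (e.2.2 z).injOn hx hz' hxy

theorem Covering.surjective (hpar : HasDepth par) {t : PTree} {r : V}
    (hr : ∀ x, par x = none ↔ x = r) (e : Covering t par r) : Function.Surjective e.1 := by
  obtain ⟨dep, -, hdep⟩ := hpar
  intro v
  induction hk : dep (some v) using Nat.strong_induction_on generalizing v with
  | _ k ih =>
    cases hv : par v with
    | none => exact ⟨t.root, by rw [e.2.1, (hr v).1 hv]⟩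
    | some w =>
      have h1 := hdep v
      rw [hv] at h1
      obtain ⟨z, rfl⟩ := ih (dep (some w)) (by omega) w rfl
      obtain ⟨y, -, hy⟩ := (e.2.2 z).surjOn hv
      exact ⟨y, hy⟩

/-- Coverings of a tree from its root are isomorphisms. -/
theorem card_covering (hpar : HasDepth par) {r : V} (hr : ∀ x, par x = none ↔ x = r)
    (t : PTree) : Nat.card (Covering t par r) =
      Nat.card {e : t.Pos ≃ V // ∀ x, par (e x) = (t.par x).map e} := by
  have hr0 : par r = none := (hr r).2 rfl
  refine Nat.card_eq_of_bijective (fun e : Covering t par r =>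
    (⟨Equiv.ofBijective e.1 ⟨e.injective hr0, e.surjective hpar hr⟩, e.par_eq hr0⟩ :
      {e : t.Pos ≃ V // ∀ x, par (e x) = (t.par x).map e})) ⟨fun e e' h => ?_, fun e => ?_⟩
  · refine Subtype.ext (funext fun x => ?_)
    exact DFunLike.congr_fun (Subtype.ext_iff.1 h) x
  · have h := par_eq_some_iff_of_comm e.2
    refine ⟨⟨e.1, ?_, fun x => ⟨fun y hy => (h x y).2 hy, e.1.injective.injOn, fun z hz => ?_⟩⟩,
      Subtype.ext (Equiv.ext fun x => rfl)⟩
    · rw [← hr, e.2, (t.par_eq_none_iff _).2 rfl, Option.map_none]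
    · obtain ⟨y, rfl⟩ := e.1.surjective z
      exact ⟨y, (h x y).1 hz, rfl⟩

variable {d : {d : ℕ // d ≠ 1}} (ch : Fin d → PTree)

/-- The covering of `v` obtained from coverings of its children by the branches. -/
def Covering.glue {v : V} (p : Σ σ : Fin d ≃ {y // par y = some v}, ∀ k, Covering (ch k) par (σ k)) :
    Covering (PTree.mk d ch) par v := by
  refine ⟨(PTree.funEquiv ch V).symm (v, fun k => (p.2 k).1), rfl, fun x => ?_⟩
  rcases PTree.eq_root_or_eq_sub ch x with rfl | ⟨k, x, rfl⟩
  · refine ⟨fun y hy => ?_, fun y hy y' hy' hyy => ?_, fun z hz => ?_⟩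
    · rcases PTree.eq_root_or_eq_sub ch y with rfl | ⟨k, y, rfl⟩
      · cases hy
      · obtain rfl := (PTree.par_sub_eq_root_iff ch k y).1 hy
        change par ((p.2 k).1 (ch k).root) = some v
        rw [(p.2 k).2.1]
        exact (p.1 k).2
    · rcases PTree.eq_root_or_eq_sub ch y with rfl | ⟨k, y, rfl⟩
      · cases hy
      rcases PTree.eq_root_or_eq_sub ch y' with rfl | ⟨k', y', rfl⟩
      · cases hy'
      obtain rfl := (PTree.par_sub_eq_root_iff ch k y).1 hy
      obtain rfl := (PTree.par_sub_eq_root_iff ch k' y').1 hy'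
      change (p.2 k).1 (ch k).root = (p.2 k').1 (ch k').root at hyy
      rw [(p.2 k).2.1, (p.2 k').2.1] at hyy
      obtain rfl := p.1.injective (Subtype.ext hyy)
      rfl
    · obtain ⟨k, hk⟩ := p.1.surjective ⟨z, hz⟩
      refine ⟨PTree.sub ch k (ch k).root, (PTree.par_sub_eq_root_iff ch k _).2 rfl, ?_⟩
      change (p.2 k).1 (ch k).root = z
      rw [(p.2 k).2.1, hk]
  · have hb := (p.2 k).2.2 x
    refine ⟨fun y hy => ?_, fun y hy y' hy' hyy => ?_, fun z hz => ?_⟩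
    · rcases PTree.eq_root_or_eq_sub ch y with rfl | ⟨k', y, rfl⟩
      · cases hy
      by_cases hk : k' = k
      · subst hk
        exact hb.mapsTo ((PTree.par_sub_eq_sub_iff ch _ _ _).1 hy)
      · exact absurd hy (PTree.par_sub_ne_sub ch hk _ _)
    · rcases PTree.eq_root_or_eq_sub ch y with rfl | ⟨k', y, rfl⟩
      · cases hy
      rcases PTree.eq_root_or_eq_sub ch y' with rfl | ⟨k'', y', rfl⟩
      · cases hy'
      by_cases hk : k' = k
      · subst hk
        by_cases hk' : k'' = k'
        · subst hk'
          exact congrArg _ (hb.injOn ((PTree.par_sub_eq_sub_iff ch _ _ _).1 hy)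
            ((PTree.par_sub_eq_sub_iff ch _ _ _).1 hy') hyy)
        · exact absurd hy' (PTree.par_sub_ne_sub ch hk' _ _)
      · exact absurd hy (PTree.par_sub_ne_sub ch hk _ _)
    · obtain ⟨y, hy, hyz⟩ := hb.surjOn hz
      exact ⟨PTree.sub ch k y, (PTree.par_sub_eq_sub_iff ch _ _ _).2 hy, hyz⟩

/-- The recursion for coverings: the images of the branch roots order the children of `v`, and each
branch restricts to a covering of its child. The local definition of a covering is what makes this
decomposition possible. -/
theorem Covering.glue_bijective (v : V) :
    Function.Bijective (Covering.glue (par := par) (v := v) ch) := by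
  constructor
  · rintro ⟨σ, c⟩ ⟨σ', c'⟩ h
    have hc : ∀ k x, (c k).1 x = (c' k).1 x := fun k x =>
      congrFun (Subtype.ext_iff.1 h) (PTree.sub ch k x)
    obtain rfl : σ = σ' := by
      ext k
      rw [← (c k).2.1, ← (c' k).2.1, hc]
    congr 1
    funext k
    exact Subtype.ext (funext fun x => hc k x)
  · rintro ⟨e, he, hb⟩
    have hroot : ∀ k, par (e (PTree.sub ch k (ch k).root)) = some v := fun k => by
      rw [← he]
      exact (hb _).mapsTo ((PTree.par_sub_eq_root_iff ch k _).2 rfl)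
    let σ : Fin d ≃ {y // par y = some v} := Equiv.ofBijective
      (fun k => ⟨e (PTree.sub ch k (ch k).root), hroot k⟩) (by
        constructor
        · intro k k' hk
          by_contra hne
          exact PTree.sub_ne_sub ch hne _ _ ((hb (PTree.mk d ch).root).injOn
            ((PTree.par_sub_eq_root_iff ch k _).2 rfl)
            ((PTree.par_sub_eq_root_iff ch k' _).2 rfl) (Subtype.ext_iff.1 hk))
        · rintro ⟨y, hy⟩
          rw [← he] at hy
          obtain ⟨z, hz, hzy⟩ := (hb (PTree.mk d ch).root).surjOn hy
          rcases PTree.eq_root_or_eq_sub ch z with rfl | ⟨k, z, rfl⟩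
          · cases hz
          · obtain rfl := (PTree.par_sub_eq_root_iff ch k z).1 hz
            exact ⟨k, Subtype.ext hzy⟩)
    refine ⟨⟨σ, fun k => ⟨fun x => e (PTree.sub ch k x), rfl, fun x => ?_⟩⟩, ?_⟩
    · have hk := hb (PTree.sub ch k x)
      refine ⟨fun y hy => hk.mapsTo ((PTree.par_sub_eq_sub_iff ch _ _ _).2 hy),
        fun y hy y' hy' hyy => PTree.sub_injective ch k (hk.injOn
          ((PTree.par_sub_eq_sub_iff ch _ _ _).2 hy) ((PTree.par_sub_eq_sub_iff ch _ _ _).2 hy')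
            hyy), fun z hz => ?_⟩
      obtain ⟨y, hy, hyz⟩ := hk.surjOn hz
      rcases PTree.eq_root_or_eq_sub ch y with rfl | ⟨k', y, rfl⟩
      · cases hy
      by_cases hkk : k' = k
      · subst hkk
        exact ⟨y, (PTree.par_sub_eq_sub_iff ch _ _ _).1 hy, hyz⟩
      · exact absurd hy (PTree.par_sub_ne_sub ch hkk _ _)
    · refine Subtype.ext (funext fun x => ?_)
      rcases PTree.eq_root_or_eq_sub ch x with rfl | ⟨k, x, rfl⟩
      · exact he.symm
      · rfl

theorem card_covering_mk [Fintype V] [DecidableEq V] (v : V) :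
    Nat.card (Covering (PTree.mk d ch) par v) =
      ∑ σ : Fin d ≃ {y // par y = some v}, ∏ k, Nat.card (Covering (ch k) par (σ k)) := by
  rw [← Nat.card_eq_of_bijective _ (Covering.glue_bijective ch v), Nat.card_sigma]
  simp only [Nat.card_pi]

variable {n : ℕ} {R : Type*} [CommRing R] [Algebra ℚ R] [UniformSpace R] [DiscreteUniformity R]

/-- Induction from the leaves to the root. The children of `v` can be ordered in `d!` ways, which
cancels the factor `1/d!` of the root of `t`, and each child contributes total weight 1 by
induction. -/
theorem hasSum_weight_mul_card_covering [Fintype V] [DecidableEq V] (hpar : HasDepth par)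
    (hcard : ∀ x, ({y | par y = some x} : Finset V).card ≠ 1) (v : V) :
    HasSum (fun t : PTree => algebraMap ℚ (MvPowerSeries (Fin n) R)
      (t.weight * Nat.card (Covering t par v))) 1 := by
  obtain ⟨dep, -, hdep⟩ := hpar
  obtain ⟨B, hB⟩ : ∃ B, ∀ x, dep (some x) ≤ B :=
    ⟨univ.sup fun x => dep (some x), fun x => Finset.le_sup (f := fun x => dep (some x))
      (Finset.mem_univ x)⟩
  -- Children are deeper than `v`, so their distance to the bound `B` is smaller.
  induction hk : B - dep (some v) using Nat.strong_induction_on generalizing v with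
  | _ k ih =>
  have ih' : ∀ y : {y // par y = some v}, HasSum (fun t : PTree =>
      algebraMap ℚ (MvPowerSeries (Fin n) R) (t.weight * Nat.card (Covering t par y.1))) 1 := by
    rintro ⟨y, hy⟩
    refine ih _ ?_ y rfl
    have h1 := hdep y
    rw [hy] at h1
    have h2 := hB y
    omega
  have hd0 : Fintype.card {y // par y = some v} ≠ 1 := by
    rw [Fintype.card_subtype]
    exact hcard v
  let d0 : {d : ℕ // d ≠ 1} := ⟨Fintype.card {y // par y = some v}, hd0⟩
  have hinj : Function.Injective (PTree.mk d0) := fun ch ch' h => by cases h; rfl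
  -- Only trees whose root arity is the number of children of `v` have coverings.
  rw [← hinj.hasSum_iff]
  · have h1 : ∀ σ : Fin d0 ≃ {y // par y = some v}, HasSum (fun ch : Fin d0 → PTree =>
        ∏ k, algebraMap ℚ (MvPowerSeries (Fin n) R)
          ((ch k).weight * Nat.card (Covering (ch k) par (σ k)))) (∏ k : Fin d0, 1) :=
      fun σ => hasSum_pi_prod (f := fun k (t : PTree) => algebraMap ℚ (MvPowerSeries (Fin n) R)
        (t.weight * Nat.card (Covering t par (σ k)))) (a := fun _ => 1) fun k => ih' (σ k)
    have h2 := (hasSum_sum (s := univ) fun σ _ => h1 σ).mul_left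
      (algebraMap ℚ (MvPowerSeries (Fin n) R) (d0.1.factorial : ℚ)⁻¹)
    have hval : algebraMap ℚ (MvPowerSeries (Fin n) R) (d0.1.factorial : ℚ)⁻¹ *
        ∑ σ : Fin d0 ≃ {y // par y = some v}, ∏ k : Fin d0, 1 = 1 := by
      have hc : Fintype.card (Fin d0 ≃ {y // par y = some v}) = d0.1.factorial := by
        rw [Fintype.card_equiv (Fintype.equivFin _).symm, Fintype.card_fin]
      simp only [Finset.prod_const_one, Finset.sum_const, Finset.card_univ, hc, nsmul_eq_mul,
        mul_one]
      rw [← map_natCast (algebraMap ℚ (MvPowerSeries (Fin n) R)), ← map_mul, inv_mul_cancel₀,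
        map_one]
      positivity
    rw [hval] at h2
    refine h2.congr_fun fun ch => ?_
    simp only [Function.comp, ← map_prod, ← map_sum, ← map_mul]
    congr 1
    rw [PTree.weight, card_covering_mk, mul_assoc]
    congr 1
    push_cast
    rw [Finset.mul_sum]
    exact Finset.sum_congr rfl fun σ _ => Finset.prod_mul_distrib.symm
  · rintro ⟨d, ch⟩ hd
    have : IsEmpty (Fin d ≃ {y // par y = some v}) := by
      refine ⟨fun σ => hd ?_⟩
      obtain rfl : d = d0 := Subtype.ext (by simpa using Fintype.card_congr σ)
      exact ⟨ch, rfl⟩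
    rw [card_covering_mk, Fintype.sum_empty, Nat.cast_zero, mul_zero, map_zero]

end Covering

/-! ### The sum over isomorphism classes -/

namespace PTree

/-- The diagram of a planar tree. -/
def diagram (t : PTree) : Feynman (Fin 1) Empty (Fin (Fintype.card (t.Pos ⊕ t.Pos))) :=
  (exists_isPres t.par_eq_none_iff t.card_children_ne_one (Fintype.equivFin _)).choose

theorem isPres_diagram (t : PTree) : IsPres t.diagram t.par
    (fun x => Fintype.equivFin (t.Pos ⊕ t.Pos) (Sum.inl x))
    fun x => Fintype.equivFin (t.Pos ⊕ t.Pos) (Sum.inr x) :=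
  (exists_isPres t.par_eq_none_iff t.card_children_ne_one (Fintype.equivFin _)).choose_spec

/-- The class of the diagram of a planar tree. -/
def toClass (t : PTree) : ConnClass (Fin 1) Empty :=
  Quotient.mk _ ⟨_, t.diagram, t.isPres_diagram.connected_of_hasDepth t.hasDepth_par⟩

end PTree

section Sum

variable {n : ℕ} {R : Type*} [CommRing R] (F : Fin n → MvPowerSeries (Fin n) R)

theorem PTree.amplitude_diagram (t : PTree) (i : Fin n) :
    t.diagram.amplitude F (fun _ => i) (Empty.elim : Empty → Fin n) = t.amp F i := by
  rw [t.isPres_diagram.amplitude_eq F ((t.par_eq_none_iff _).2 rfl), t.parAmplitude_eq_amp]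

/-- Composition with one isomorphism identifies all isomorphisms with automorphisms. -/
theorem Feynman.IsIso.card_isIso {I J E E' : Type*} [Fintype E] [DecidableEq E] [Fintype E']
    [DecidableEq E'] {D : Feynman I J E} {D' : Feynman I J E'} {σ : E ≃ E'} (h : D.IsIso D' σ) :
    Nat.card {σ : E ≃ E' // D.IsIso D' σ} = D'.autCard :=
  Nat.card_congr
    { toFun := fun s => ⟨σ.symm.trans s.1, h.symm.trans s.2⟩
      invFun := fun s => ⟨σ.trans s.1, h.trans s.2⟩
      left_inv := fun s => by ext; simp
      right_inv := fun s => by ext; simp }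

theorem Feynman.autCard_pos {I J E : Type*} [Fintype E] [DecidableEq E] (D : Feynman I J E) :
    0 < D.autCard :=
  have : Nonempty {σ : E ≃ E // D.IsIso D σ} := ⟨⟨_, Feynman.IsIso.refl D⟩⟩
  Nat.card_pos

variable [Algebra ℚ R] [UniformSpace R] [DiscreteUniformity R]

/-- The weighted count of coverings is multiplied by `𝓐/#Aut`. For a planar tree in the class, the
number of coverings is `#Aut` and cancels the denominator; for any other tree it is zero. -/
theorem hasSum_fiber (i : Fin n) (c : ConnClass (Fin 1) Empty) :
    HasSum (fun t : {t : PTree // t.toClass = c} => t.1.weight • t.1.amp F i)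
      (connTerm F (fun _ : Fin 1 => i) (Empty.elim : Empty → Fin n) c) := by
  classical
  induction c using Quotient.inductionOn with
  | _ D =>
  obtain ⟨m, D, hD⟩ := D
  have h := D.isPres_parent
  have hpar := h.hasDepth_of_connected hD
  obtain ⟨r, hr⟩ := h.exists_root
  have hr' : ∀ x, D.parent x = none ↔ x = r := fun x =>
    ⟨fun hx => h.root_unique hx hr, fun hx => hx ▸ hr⟩
  have hs := hasSum_weight_mul_card_covering (n := n) (R := R) hpar h.card_children_ne_one r
  have hs := hs.mul_right ((D.autCard : ℚ)⁻¹ • D.amplitude F (fun _ => i) Empty.elim)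
  rw [one_mul] at hs
  rw [← (Subtype.val_injective (p := fun t : PTree => t.toClass = _)).hasSum_iff] at hs
  · refine hs.congr_fun ?_
    rintro ⟨t, ht⟩
    obtain ⟨σ, hσ⟩ := Quotient.exact ht
    have hσ : t.diagram.IsIso D σ := hσ
    have hc : Nat.card (Covering t D.parent r) = D.autCard := by
      rw [card_covering hpar hr', ← t.isPres_diagram.card_isIso h, hσ.card_isIso]
    have h0 : (D.autCard : ℚ) ≠ 0 := by exact_mod_cast D.autCard_pos.ne'
    simp only [Function.comp]
    rw [hc, ← Algebra.smul_def, smul_smul, mul_assoc, mul_inv_cancel₀ h0, mul_one,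
      ← hσ.amplitude_eq, t.amplitude_diagram]
  · intro t ht
    have hempty : IsEmpty {σ // t.diagram.IsIso D σ} :=
      ⟨fun σ => ht ⟨⟨t, Quotient.sound ⟨σ.1, σ.2⟩⟩, rfl⟩⟩
    rw [card_covering hpar hr', ← t.isPres_diagram.card_isIso h, Nat.card_of_isEmpty,
      Nat.cast_zero, mul_zero, map_zero, zero_mul]

theorem hasSum_connTerm (i : Fin n) :
    HasSum (connTerm F (fun _ : Fin 1 => i) (Empty.elim : Empty → Fin n)) (treeSeries F i) := by
  have h := hasSum_treeSeries F i
  rw [← (Equiv.sigmaFiberEquiv PTree.toClass).hasSum_iff] at h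
  exact HasSum.sigma h fun c => hasSum_fiber F i c

end Sum
end FeynRev

end

/-! ### The quotient of Gaussian integrals as a sum over connected diagrams. -/

theorem corollary1 {n : ℕ} {R : Type*} [CommRing R] [Algebra ℚ R]
    (F : Fin n → MvPowerSeries (Fin n) R)
    (hF : ∀ i, MvPowerSeries.constantCoeff (F i) = 0)
    (hA : IsUnit (FeynRev.linMatrix F)) (i : Fin n) :
    FeynRev.GaussIntegrable (FeynRev.linMatrix F)
        (MvPowerSeries.X (FeynRev.uVar i) * FeynRev.expInteraction F) ∧
    FeynRev.GaussIntegrable (FeynRev.linMatrix F) (FeynRev.expInteraction F) ∧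
    IsUnit (FeynRev.gaussIntegral (FeynRev.linMatrix F) (FeynRev.expInteraction F)) ∧
    FeynRev.SummableFamily
      (FeynRev.connTerm F (fun _ : Fin 1 => i) (Empty.elim : Empty → Fin n)) ∧
    FeynRev.gaussIntegral (FeynRev.linMatrix F)
        (MvPowerSeries.X (FeynRev.uVar i) * FeynRev.expInteraction F) *
      Ring.inverse (FeynRev.gaussIntegral (FeynRev.linMatrix F) (FeynRev.expInteraction F)) =
      FeynRev.connCorrelation F (fun _ : Fin 1 => i) (Empty.elim : Empty → Fin n) ∧
    ∀ (E : Type) [Fintype E] [DecidableEq E] (D : FeynRev.Feynman (Fin 1) Empty E),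
      D.Connected → D.TreeLike ∧ D.LeavesAreY := by
  -- The statement involves no topology; the discrete uniformity on `R` makes its notions of
  -- summability and sum agree with `Summable` and `HasSum`.
  let _ : UniformSpace R := ⊥
  have _ : DiscreteUniformity R := ⟨rfl⟩
  have h0 : FeynRev.gaussIntegral (FeynRev.linMatrix F) (FeynRev.expInteraction F) =
      FeynRev.moment F 0 := by
    rw [FeynRev.gaussIntegral, FeynRev.gaussTerm_expInteraction, FeynRev.moment]
  have h1 := FeynRev.hasSum_gaussTerm_X_mul F i
  have hunit := FeynRev.isUnit_moment_zero F hA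
  have hconn := FeynRev.hasSum_connTerm F i
  refine ⟨?_, ?_, ?_, ?_, ?_, fun E _ _ D hD => ⟨hD.treeLike, D.leavesAreY⟩⟩
  · exact FeynRev.summableFamily_of_hasSum h1
  · rw [FeynRev.GaussIntegrable, FeynRev.gaussTerm_expInteraction]
    exact FeynRev.momentTerm_summable F 0
  · rwa [h0]
  · exact FeynRev.summableFamily_of_hasSum hconn
  · rw [h0, FeynRev.gaussIntegral, FeynRev.familySum_eq_of_hasSum h1, FeynRev.connCorrelation,
      FeynRev.familySum_eq_of_hasSum hconn, FeynRev.moment_single_eq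
        (FeynRev.constantCoeff_treeSeries F) (FeynRev.treeSeries_eq F) i, mul_assoc,
      Ring.mul_inverse_cancel _ hunit, mul_one]
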